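/- Alphabets are finite sets. For a word $w\in X^*$ let $\Psi(w)\in\mathbb N^X$ be its Parikh vector, i.e. $\Psi(w)(x)$ is the number of occurrences of $x$ in $w$, and let $\Psi(L)=\{\Psi(w)\mid w\in L\}$ for $L\subseteq X^*$. *Finite-index languages.* Let $G=(N,T,P,S)$ be a context-free grammar in Chomsky normal form, meaning that every production $A\to w$ has $w\in N^2\cup T\cup\{\varepsilon\}$. For $k\ge 1$ let $L_k(G)$ be the set of words in $T^*$ that can be derived from $S$ by a derivation in which every sentential form contains at most $k$ occurrences of nonterminals. Let $\mathsf{fiCF}$ be the class of all languages $L_k(G)$ for such $G$ and $k\ge 1$. *Petri net languages.* A $d$-dimensional labeled Petri net over $X$ consists of a finite set of transitions in $(X\cup\{\varepsilon\})\times\mathbb Z^d$, an initial marking in $\mathbb N^d$ and a finite set of final markings in $\mathbb N^d$. A transition $(x,\nu)$ leads from $\mu\in\mathbb N^d$ to $\mu+\nu$, provided that $\mu+\nu\in\mathbb N^d$, and reads $x$. The generated language consists of the words read on firing sequences from the initial marking to a final marking. Let $\mathsf P$ be the class of all these languages. *The class $\mathsf{fiCF}\sqcap\mathsf P$* consists of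 all languages $h(K\cap L)\subseteq Y^*$, where $K,L\subseteq X^*$ for some alphabet $X$, $K\in\mathsf{fiCF}$, $L\in\mathsf P$, and $h\colon X^*\to Y^*$ is a morphism. Such a language is represented by a grammar $G$ in Chomsky normal form, a number $k\ge 1$, a Petri net, and the images under $h$ of the letters. *Priority multicounter machines.* A priority $k$-counter machine over $Y$ consists of a finite state set $Q$, an initial state $q_0\in Q$, a set $F\subseteq Q$ of final states and a finite set of edges in $Q\times Y^*\times\{0,\dots,k\}\times\mathbb Z^k\times Q$. An edge $(p,w,\ell,\nu,q)$ leads from a configuration $(p,\mu)\in Q\times\mathbb N^k$ to $(q,\mu+\nu)$ and reads $w$, provided that $\mu_1=\dots=\mu_\ell=0$ and $\mu+\nu\in\mathbb N^k$. The machine accepts the words read on runs from $(q_0,0)$ to $(f,0)$ with $f\in F$. A priority multicounter machine is a priority $k$-counter machine for some $k\in\mathbb N$. **Theorem.** For every language $K$ in $\mathsf{fiCF}\sqcap\mathsf P$ there is a priority multicounter machine $\mathcal A$ (over the alphabet of $K$) with $\Psi(L(\mathcal A))=\Psi(K)$. Moreover, $\mathcal A$ can be constructed effectively: there is a computable function that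 maps every representation of a language $K\in\mathsf{fiCF}\sqcap\mathsf P$ to a priority multicounter machine $\mathcal A$ with $\Psi(L(\mathcal A))=\Psi(K)$. -/

import Mathlib

/-! ### Parikh images -/

/-- The Parikh map: `parikh w x` is the number of occurrences of the letter `x` in `w`. -/
def parikh {X : Type*} [DecidableEq X] (w : List X) : X → ℕ := fun x => w.count x

/-- The Parikh image of a language. -/
def parikhImage {X : Type*} [DecidableEq X] (L : Language X) : Set (X → ℕ) :=
  {v | ∃ w ∈ L, parikh w = v}

/-! ### Finite-index context-free languages -/

/-- Whether a grammar symbol is a nonterminal. -/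
def symbolIsNonterminal {T N : Type*} : Symbol T N → Bool
  | .terminal _ => false
  | .nonterminal _ => true

/-- The number of occurrences of nonterminals in a sentential form. -/
def nonterminalCount {T N : Type*} (u : List (Symbol T N)) : ℕ :=
  u.countP symbolIsNonterminal

/-- Chomsky normal form: each right-hand side is two nonterminals, or one terminal, or empty. -/
def IsChomskyNF {T : Type} (G : ContextFreeGrammar.{0} T) : Prop :=
  ∀ r ∈ G.rules,
    (∃ B C : G.NT, r.output = [Symbol.nonterminal B, Symbol.nonterminal C]) ∨
    (∃ a : T, r.output = [Symbol.terminal a]) ∨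
    r.output = []

/-- A derivation step between sentential forms with at most `k` nonterminal occurrences each. -/
def BoundedStep {T : Type} (G : ContextFreeGrammar.{0} T) (k : ℕ)
    (u v : List (Symbol T G.NT)) : Prop :=
  nonterminalCount u ≤ k ∧ nonterminalCount v ≤ k ∧ G.Produces u v

/-- The `k`-approximation of the language of a grammar: the terminal words that are derivable
from the start symbol by steps with at most `k` nonterminal occurrences. -/
def approximation {T : Type} (G : ContextFreeGrammar.{0} T) (k : ℕ) : Language T :=
  {w | Relation.ReflTransGen (BoundedStep G k)
    [Symbol.nonterminal G.initial] (w.map Symbol.terminal)}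

/-- Index-`k` context-free languages. A grammar has finitely many rules, so only finitely many
elements of the type `G.NT` matter. -/
def IsIndexCF {T : Type} (k : ℕ) (L : Language T) : Prop :=
  ∃ G : ContextFreeGrammar.{0} T, IsChomskyNF G ∧ L = approximation G k

/-- Finite-index context-free languages. -/
def IsFiniteIndexCF {T : Type} (L : Language T) : Prop :=
  ∃ k : ℕ, 1 ≤ k ∧ IsIndexCF k L

/-! ### Petri net languages -/

/-- A `d`-dimensional labeled Petri net; the label `none` stands for the empty word. -/
structure PetriNet (X : Type*) (d : ℕ) where
  transitions : Finset (Option X × (Fin d → ℤ))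
  initial : Fin d → ℕ
  final : Finset (Fin d → ℕ)

/-- `N.Run μ w μ'`: the word `w` labels a firing sequence from marking `μ` to marking `μ'`. -/
inductive PetriNet.Run {X : Type*} {d : ℕ} (N : PetriNet X d) :
    (Fin d → ℕ) → List X → (Fin d → ℕ) → Prop
  | nil (μ : Fin d → ℕ) : N.Run μ [] μ
  | cons {μ μ₁ μ' : Fin d → ℕ} {x : Option X} {ν : Fin d → ℤ} {w : List X}
      (mem : (x, ν) ∈ N.transitions) (fire : ∀ i, (μ₁ i : ℤ) = (μ i : ℤ) + ν i)
      (rest : N.Run μ₁ w μ') : N.Run μ (x.toList ++ w) μ'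

/-- The language generated by a Petri net. -/
def PetriNet.language {X : Type*} {d : ℕ} (N : PetriNet X d) : Language X :=
  {w | ∃ μ ∈ N.final, N.Run N.initial w μ}

/-- Petri net languages. -/
def IsPetriNetLanguage {X : Type*} (L : Language X) : Prop :=
  ∃ (d : ℕ) (N : PetriNet X d), L = N.language

/-! ### The class `C ⊓ D` -/

/-- `h(K ∩ L)`, for the morphism that is given by `h` on letters. -/
def morphicIntersection {X Y : Type*} (h : X → List Y) (K L : Language X) : Language Y :=
  {v | ∃ w, w ∈ K ∧ w ∈ L ∧ w.flatMap h = v}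

/-- Membership in `C ⊓ D`: the language is `h(K ∩ L)` with `K` in `C`, `L` in `D` over some
common finite alphabet, and `h` a morphism. -/
def InTrioIntersection (C D : (X : Type) → Language X → Prop) {Y : Type*} (M : Language Y) :
    Prop :=
  ∃ (X : Type) (_ : Finite X) (h : X → List Y) (K L : Language X),
    C X K ∧ D X L ∧ M = morphicIntersection h K L

/-! ### Priority multicounter machines -/

/-- A priority `k`-counter machine. An edge `(p, w, ℓ, ν, q)` goes from state `p` to `q`, reads
`w`, tests that the first `ℓ` counters are zero and adds `ν` to the counters. -/
structure PriorityMachine (X : Type*) (k : ℕ) where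
  State : Type
  finite_state : Finite State
  edges : Finset (State × List X × Fin (k + 1) × (Fin k → ℤ) × State)
  start : State
  final : Set State

/-- `A.Run p μ w q μ'`: the machine can go from configuration `(p, μ)` to `(q, μ')`
reading `w`. -/
inductive PriorityMachine.Run {X : Type*} {k : ℕ} (A : PriorityMachine X k) :
    A.State → (Fin k → ℕ) → List X → A.State → (Fin k → ℕ) → Prop
  | nil (p : A.State) (μ : Fin k → ℕ) : A.Run p μ [] p μ
  | cons {p p₁ q : A.State} {μ μ₁ μ' : Fin k → ℕ} {u w : List X} {l : Fin (k + 1)}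
      {ν : Fin k → ℤ} (mem : (p, u, l, ν, p₁) ∈ A.edges)
      (test : ∀ i : Fin k, (i : ℕ) < (l : ℕ) → μ i = 0)
      (add : ∀ i, (μ₁ i : ℤ) = (μ i : ℤ) + ν i)
      (rest : A.Run p₁ μ₁ w q μ') : A.Run p μ (u ++ w) q μ'

/-- The language accepted by a machine: runs go from the start state to a final state, with all
counters zero at the beginning and at the end. -/
def PriorityMachine.language {X : Type*} {k : ℕ} (A : PriorityMachine X k) : Language X :=
  {w | ∃ f ∈ A.final, A.Run A.start 0 w f 0}

/-! ### Finite representations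

For effectiveness, letters, nonterminals and states are natural numbers. The alphabets are the
finite sets of numbers that occur; vectors are lists, read as padded by zeros. -/

/-- A context-free grammar: start symbol and productions (`inl`: terminal,
`inr`: nonterminal). -/
structure GrammarCode where
  start : ℕ
  rules : List (ℕ × List (ℕ ⊕ ℕ))

/-- The grammar symbol that is represented by an element of `ℕ ⊕ ℕ`. -/
def symbolOfCode : ℕ ⊕ ℕ → Symbol ℕ ℕ
  | .inl a => .terminal a
  | .inr A => .nonterminal A

/-- The set of productions that is represented by a code. -/
def GrammarCode.ruleSet (c : GrammarCode) : Finset (ContextFreeRule ℕ ℕ) :=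
  (c.rules.map fun r => ContextFreeRule.mk r.1 (r.2.map symbolOfCode)).toFinset

/-- The grammar that is represented by a code. -/
def GrammarCode.toGrammar (c : GrammarCode) : ContextFreeGrammar.{0} ℕ where
  NT := ℕ
  initial := c.start
  rules := c.ruleSet

/-- A Petri net: dimension, transitions, initial marking, final markings. -/
structure PetriNetCode where
  dim : ℕ
  transitions : List (Option ℕ × List ℤ)
  initial : List ℕ
  final : List (List ℕ)

/-- The vector with the entries of a list, padded by zeros or cut off. -/
def vectorOfList {R : Type*} [Zero R] (d : ℕ) (l : List R) : Fin d → R :=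
  fun i => l.getD i 0

/-- The Petri net that is represented by a code. -/
def PetriNetCode.toPetriNet (c : PetriNetCode) : PetriNet ℕ c.dim where
  transitions := (c.transitions.map fun t => (t.1, vectorOfList c.dim t.2)).toFinset
  initial := vectorOfList c.dim c.initial
  final := (c.final.map (vectorOfList c.dim)).toFinset

/-- A representation of a language `h(K ∩ L)`: a grammar and an index bound for `K`, a Petri net
for `L`, and the list `h(0), h(1), …` of the images of the letters (later letters are mapped
to the empty word). -/
structure LanguageCode where
  grammar : GrammarCode
  index : ℕ
  net : PetriNetCode
  images : List (List ℕ)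

/-- A language code is valid if its grammar is in Chomsky normal form and its index is
positive. -/
def LanguageCode.Valid (c : LanguageCode) : Prop :=
  IsChomskyNF c.grammar.toGrammar ∧ 1 ≤ c.index

/-- The language that is represented by a code. -/
def LanguageCode.language (c : LanguageCode) : Language ℕ :=
  morphicIntersection (fun x => c.images.getD x [])
    (approximation c.grammar.toGrammar c.index) c.net.toPetriNet.language

/-- A priority multicounter machine: number `k` of counters, largest state `n`, edges, start
state, final states. -/
structure MachineCode where
  counters : ℕ
  maxState : ℕ
  edges : List (ℕ × List ℕ × ℕ × List ℤ × ℕ)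
  start : ℕ
  final : List ℕ

/-- The machine that is represented by a code, with state set `{0, …, n}`. Numbers of states are
read modulo `n + 1` and numbers of tested counters modulo `k + 1`, so that every code represents
a machine. -/
def MachineCode.toMachine (c : MachineCode) : PriorityMachine ℕ c.counters where
  State := Fin (c.maxState + 1)
  finite_state := inferInstance
  edges := (c.edges.map fun e =>
    (Fin.ofNat (c.maxState + 1) e.1, e.2.1, Fin.ofNat (c.counters + 1) e.2.2.1,
      vectorOfList c.counters e.2.2.2.1, Fin.ofNat (c.maxState + 1) e.2.2.2.2)).toFinset
  start := Fin.ofNat (c.maxState + 1) c.start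
  final := {q | ∃ n ∈ c.final, q = Fin.ofNat (c.maxState + 1) n}

def GrammarCode.equiv : GrammarCode ≃ ℕ × List (ℕ × List (ℕ ⊕ ℕ)) where
  toFun c := (c.start, c.rules)
  invFun p := ⟨p.1, p.2⟩
  left_inv _ := rfl
  right_inv _ := rfl

instance GrammarCode.primcodable : Primcodable GrammarCode :=
  Primcodable.ofEquiv _ GrammarCode.equiv

def PetriNetCode.equiv :
    PetriNetCode ≃ ℕ × List (Option ℕ × List ℤ) × List ℕ × List (List ℕ) where
  toFun c := (c.dim, c.transitions, c.initial, c.final)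
  invFun p := ⟨p.1, p.2.1, p.2.2.1, p.2.2.2⟩
  left_inv _ := rfl
  right_inv _ := rfl

instance PetriNetCode.primcodable : Primcodable PetriNetCode :=
  Primcodable.ofEquiv _ PetriNetCode.equiv

def LanguageCode.equiv :
    LanguageCode ≃ GrammarCode × ℕ × PetriNetCode × List (List ℕ) where
  toFun c := (c.grammar, c.index, c.net, c.images)
  invFun p := ⟨p.1, p.2.1, p.2.2.1, p.2.2.2⟩
  left_inv _ := rfl
  right_inv _ := rfl

instance LanguageCode.primcodable : Primcodable LanguageCode :=
  Primcodable.ofEquiv _ LanguageCode.equiv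

def MachineCode.equiv :
    MachineCode ≃ ℕ × ℕ × List (ℕ × List ℕ × ℕ × List ℤ × ℕ) × ℕ × List ℕ where
  toFun c := (c.counters, c.maxState, c.edges, c.start, c.final)
  invFun p := ⟨p.1, p.2.1, p.2.2.1, p.2.2.2.1, p.2.2.2.2⟩
  left_inv _ := rfl
  right_inv _ := rfl

instance MachineCode.primcodable : Primcodable MachineCode :=
  Primcodable.ofEquiv _ MachineCode.equiv

/-! A derivation with at most `k` nonterminals in each sentential form can be rearranged into a tree
graded by index: at a binary node of index `l + 1`, one of the two subtrees has index `l`. Of the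
two interleaved derivations below such a node, the one that finishes first always runs beside a
nonterminal of the other and therefore obeys the smaller bound (`CountedDerivation.split`,
`mem_approximation_iff`). The tree is thus a spine of constant index that ends in a leaf, with
subtrees of smaller index hanging off to the left and to the right.

Together with a firing sequence, a subtree becomes a transition from a marking `a` to a marking `b`.
The counter machine builds a spine from its leaf upwards and stores the current pair `(a, b)` as the
left and the right marking of a level. At the leaf it guesses one marking for both sides and lets
the right one fire. A subtree hanging off to the right, leading from `x` to `y`, is computed in the
same way on the next lower level; then `x` is subtracted from the right marking above and `y` is
added to it. A subtree on the left is treated backwards on the left marking. Subtrees are therefore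
read in the wrong order, which the Parikh image does not see. The nesting depth is less than `k`, so
the pending productions fit into the finite control.

Zero tests are needed only to ensure that the lower level has been used up. All levels below it are
empty at that time, so a prefix of the levels is tested, as priorities demand. Nothing has to be
tested on the upper level: firing is monotone (`Der.add_left`), so a surplus above `x` is just
carried along.

Soundness is an invariant (`MRun.inv`), completeness an induction on derivations (`Der.mrun`); they
are joined in `mem_images_iff_mrun`. For effectiveness, all data of the machine are lists that
depend primitive recursively on the code. -/

/-! ### Bounded derivations, organized as trees -/

/-- `IndexedDerivation G l A w`: the word `w` has a derivation tree with root `A` in which, at each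
binary node of index `l + 1`, one of the two children has index `l`. -/
inductive IndexedDerivation {T : Type} (G : ContextFreeGrammar.{0} T) :
    ℕ → G.NT → List T → Prop
  | nil {l : ℕ} {A : G.NT} (mem : ContextFreeRule.mk A [] ∈ G.rules) :
      IndexedDerivation G (l + 1) A []
  | leaf {l : ℕ} {A : G.NT} {t : T}
      (mem : ContextFreeRule.mk A [Symbol.terminal t] ∈ G.rules) :
      IndexedDerivation G (l + 1) A [t]
  | right {l : ℕ} {A B C : G.NT} {u w : List T}
      (mem : ContextFreeRule.mk A [Symbol.nonterminal B, Symbol.nonterminal C] ∈ G.rules)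
      (hB : IndexedDerivation G (l + 1) B u) (hC : IndexedDerivation G l C w) :
      IndexedDerivation G (l + 1) A (u ++ w)
  | left {l : ℕ} {A B C : G.NT} {u w : List T}
      (mem : ContextFreeRule.mk A [Symbol.nonterminal B, Symbol.nonterminal C] ∈ G.rules)
      (hB : IndexedDerivation G l B u) (hC : IndexedDerivation G (l + 1) C w) :
      IndexedDerivation G (l + 1) A (u ++ w)

section BoundedDerivations

variable {T : Type} {G : ContextFreeGrammar.{0} T}

theorem nonterminalCount_append {N : Type*} (u v : List (Symbol T N)) :
    nonterminalCount (u ++ v) = nonterminalCount u + nonterminalCount v := by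
  simp [nonterminalCount]

theorem nonterminalCount_terminals {N : Type*} (w : List T) :
    nonterminalCount (w.map (Symbol.terminal : T → Symbol T N)) = 0 := by
  simp [nonterminalCount, symbolIsNonterminal]

theorem nonterminalCount_nonterminal {N : Type*} (A : N) :
    nonterminalCount [(Symbol.nonterminal A : Symbol T N)] = 1 := by
  simp [nonterminalCount, symbolIsNonterminal]

theorem nonterminalCount_pair {N : Type*} (A B : N) :
    nonterminalCount [(Symbol.nonterminal A : Symbol T N), Symbol.nonterminal B] = 2 := rfl

theorem nonterminalCount_pos_of_produces {u v : List (Symbol T G.NT)} (h : G.Produces u v) :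
    1 ≤ nonterminalCount u := by
  obtain ⟨r, -, h⟩ := h
  obtain ⟨p, q, rfl, -⟩ := h.exists_parts
  simp only [nonterminalCount_append, nonterminalCount_nonterminal]
  omega

/-- Bounded derivations may be carried out inside a context. -/
theorem boundedStep_context {k m : ℕ} {u v : List (Symbol T G.NT)}
    (p q : List (Symbol T G.NT)) (hm : nonterminalCount p + nonterminalCount q + k ≤ m)
    (h : Relation.ReflTransGen (BoundedStep G k) u v) :
    Relation.ReflTransGen (BoundedStep G m) (p ++ u ++ q) (p ++ v ++ q) := by
  induction h with
  | refl => exact .refl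
  | tail _ h ih =>
    refine ih.tail ⟨?_, ?_, (h.2.2.append_left p).append_right q⟩
    · have := h.1
      simp only [nonterminalCount_append]
      omega
    · have := h.2.1
      simp only [nonterminalCount_append]
      omega

theorem IndexedDerivation.index_pos {l : ℕ} {A : G.NT} {w : List T}
    (h : IndexedDerivation G l A w) : 1 ≤ l := by
  cases h <;> omega

/-- The child of smaller index is expanded first, while its sibling waits as a single nonterminal.
Afterwards the sibling has only terminals around it and may use the full bound. -/
theorem IndexedDerivation.boundedDerivation {l : ℕ} {A : G.NT} {w : List T}
    (h : IndexedDerivation G l A w) :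
    Relation.ReflTransGen (BoundedStep G l) [Symbol.nonterminal A] (w.map Symbol.terminal) := by
  induction h with
  | @nil l A mem =>
    refine .single ⟨?_, ?_, ⟨_, mem, ContextFreeRule.Rewrites.input_output⟩⟩
    · rw [nonterminalCount_nonterminal]
      omega
    · rw [nonterminalCount_terminals]
      omega
  | @leaf l A t mem =>
    refine .single ⟨?_, ?_, ⟨_, mem, ContextFreeRule.Rewrites.input_output⟩⟩
    · rw [nonterminalCount_nonterminal]
      omega
    · rw [nonterminalCount_terminals]
      omega
  | @right l A B C u w mem hB hC ihB ihC =>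
    have hl := hC.index_pos
    have h₁ := boundedStep_context (m := l + 1) [Symbol.nonterminal B] []
      (by rw [nonterminalCount_nonterminal]; simp [nonterminalCount]; omega) ihC
    have h₂ := boundedStep_context (m := l + 1) [] (w.map Symbol.terminal)
      (by rw [nonterminalCount_terminals]; simp [nonterminalCount]) ihB
    refine .head ⟨?_, ?_, ⟨_, mem, ContextFreeRule.Rewrites.input_output⟩⟩ ?_
    · rw [nonterminalCount_nonterminal]
      omega
    · rw [nonterminalCount_pair]
      omega
    · simpa using h₁.trans (by simpa using h₂)
  | @left l A B C u w mem hB hC ihB ihC =>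
    have hl := hB.index_pos
    have h₁ := boundedStep_context (m := l + 1) [] [Symbol.nonterminal C]
      (by rw [nonterminalCount_nonterminal]; simp [nonterminalCount]; omega) ihB
    have h₂ := boundedStep_context (m := l + 1) (u.map Symbol.terminal) []
      (by rw [nonterminalCount_terminals]; simp [nonterminalCount]) ihC
    refine .head ⟨?_, ?_, ⟨_, mem, ContextFreeRule.Rewrites.input_output⟩⟩ ?_
    · rw [nonterminalCount_nonterminal]
      omega
    · rw [nonterminalCount_pair]
      omega
    · simpa using h₁.trans (by simpa using h₂)

/-- Bounded derivations of terminal words, with their number of steps. -/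
inductive CountedDerivation (G : ContextFreeGrammar.{0} T) (k : ℕ) :
    ℕ → List (Symbol T G.NT) → List T → Prop
  | refl (w : List T) : CountedDerivation G k 0 (w.map Symbol.terminal) w
  | head {n : ℕ} {u v : List (Symbol T G.NT)} {w : List T} (step : BoundedStep G k u v)
      (rest : CountedDerivation G k n v w) : CountedDerivation G k (n + 1) u w

theorem exists_countedDerivation {k : ℕ} {u : List (Symbol T G.NT)} {w : List T}
    (h : Relation.ReflTransGen (BoundedStep G k) u (w.map Symbol.terminal)) :
    ∃ n, CountedDerivation G k n u w := by
  induction h using Relation.ReflTransGen.head_induction_on with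
  | refl => exact ⟨0, .refl w⟩
  | head h _ ih => exact ⟨_, .head h ih.choose_spec⟩

theorem terminals_injective {N : Type*} :
    Function.Injective (List.map (Symbol.terminal : T → Symbol T N)) :=
  List.map_injective_iff.2 fun _ _ h => by injection h

theorem CountedDerivation.eq_of_terminals {k n : ℕ} {w w' : List T}
    (h : CountedDerivation G k n (w'.map Symbol.terminal) w) : w' = w := by
  generalize hu : w'.map (Symbol.terminal : T → Symbol T G.NT) = u at h
  cases h with
  | refl => exact terminals_injective hu
  | head step _ =>
    have := nonterminalCount_pos_of_produces step.2.2
    rw [← hu, nonterminalCount_terminals] at this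
    omega

theorem exists_terminals_of_nonterminalCount_eq_zero {N : Type*} {u : List (Symbol T N)}
    (h : nonterminalCount u = 0) : ∃ w : List T, u = w.map Symbol.terminal := by
  induction u with
  | nil => exact ⟨[], rfl⟩
  | cons x u ih =>
    rw [← List.singleton_append, nonterminalCount_append] at h
    obtain ⟨w, rfl⟩ := ih (by omega)
    cases x with
    | terminal t => exact ⟨t :: w, rfl⟩
    | nonterminal A =>
      rw [nonterminalCount_nonterminal] at h
      omega

/-! ### Splitting interleaved derivations -/

theorem produces_append {p q v : List (Symbol T G.NT)} (h : G.Produces (p ++ q) v) :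
    (∃ p', v = p' ++ q ∧ G.Produces p p') ∨ (∃ q', v = p ++ q' ∧ G.Produces q q') := by
  obtain ⟨r, hr, h⟩ := h
  obtain ⟨x, y, hx, rfl⟩ := h.exists_parts
  rw [List.append_assoc, List.append_eq_append_iff] at hx
  rcases hx with ⟨a, rfl, hx⟩ | ⟨c, rfl, hx⟩
  · right
    exact ⟨a ++ r.output ++ y, by simp,
      r, hr, by rw [hx, ← List.append_assoc]; exact r.rewrites_of_exists_parts a y⟩
  -- If `c` is empty, the rewritten nonterminal is the head of `q` and not the end of `p`.
  · cases c with
    | nil =>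
      right
      simp only [List.nil_append] at hx
      exact ⟨r.output ++ y, by simp,
        r, hr, by rw [← hx]; simpa using r.rewrites_of_exists_parts [] y⟩
    | cons z c =>
      left
      simp only [List.cons_append, List.nil_append, List.cons.injEq] at hx
      obtain ⟨rfl, rfl⟩ := hx
      exact ⟨x ++ r.output ++ c, by simp,
        r, hr, by simpa using r.rewrites_of_exists_parts x c⟩

/-- A derivation from a concatenation consists of two interleaved derivations. The one that is
completed first leaves room for a nonterminal of the other one. -/
theorem CountedDerivation.split {k n : ℕ} {p q : List (Symbol T G.NT)} {w : List T}
    (h : CountedDerivation G (k + 1) n (p ++ q) w) :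
    ∃ n₁ n₂ w₁ w₂, n₁ + n₂ = n ∧ w = w₁ ++ w₂ ∧ CountedDerivation G (k + 1) n₁ p w₁ ∧
      CountedDerivation G (k + 1) n₂ q w₂ ∧
      (1 ≤ nonterminalCount p → 1 ≤ nonterminalCount q →
        CountedDerivation G k n₁ p w₁ ∨ CountedDerivation G k n₂ q w₂) := by
  generalize hu : p ++ q = u at h
  induction h generalizing p q with
  | refl w =>
    obtain ⟨w₁, w₂, rfl, rfl, rfl⟩ := List.map_eq_append_iff.1 hu.symm
    refine ⟨0, 0, w₁, w₂, rfl, rfl, .refl _, .refl _, fun h => ?_⟩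
    rw [nonterminalCount_terminals] at h
    omega
  | @head n u v w step rest ih =>
    subst hu
    obtain ⟨hu, hv, step⟩ := step
    rcases produces_append step with ⟨p', rfl, hp⟩ | ⟨q', rfl, hq⟩
    · obtain ⟨n₁, n₂, w₁, w₂, rfl, rfl, h₁, h₂, h⟩ := ih rfl
      rw [nonterminalCount_append] at hu hv
      refine ⟨n₁ + 1, n₂, w₁, w₂, by omega, rfl,
        .head ⟨by omega, by omega, hp⟩ h₁, h₂, fun hp₁ hq₁ => ?_⟩
      -- The nonterminal that is still present in `q` takes one unit of the bound `k + 1` on both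
      -- sides of this step.
      have hs : BoundedStep G k p p' := ⟨by omega, by omega, hp⟩
      by_cases hp' : 1 ≤ nonterminalCount p'
      · exact (h hp' hq₁).imp (.head hs) id
      -- This step completes `p` while `q` still has a nonterminal, so `p` is the part with the
      -- smaller bound.
      · obtain ⟨w', rfl⟩ := exists_terminals_of_nonterminalCount_eq_zero (by omega :
          nonterminalCount p' = 0)
        obtain rfl := h₁.eq_of_terminals
        left
        cases n₁ with
        | zero => exact .head hs (.refl _)
        | succ n₁ =>
          cases h₁ with
          | head step _ =>
            have := nonterminalCount_pos_of_produces step.2.2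
            omega
    · obtain ⟨n₁, n₂, w₁, w₂, rfl, rfl, h₁, h₂, h⟩ := ih rfl
      rw [nonterminalCount_append] at hu hv
      refine ⟨n₁, n₂ + 1, w₁, w₂, by omega, rfl, h₁,
        .head ⟨by omega, by omega, hq⟩ h₂, fun hp₁ hq₁ => ?_⟩
      have hs : BoundedStep G k q q' := ⟨by omega, by omega, hq⟩
      by_cases hq' : 1 ≤ nonterminalCount q'
      · exact (h hp₁ hq').imp id (.head hs)
      · obtain ⟨w', rfl⟩ := exists_terminals_of_nonterminalCount_eq_zero (by omega :
          nonterminalCount q' = 0)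
        obtain rfl := h₂.eq_of_terminals
        right
        cases n₂ with
        | zero => exact .head hs (.refl _)
        | succ n₂ =>
          cases h₂ with
          | head step _ =>
            have := nonterminalCount_pos_of_produces step.2.2
            omega

theorem produces_nonterminal {A : G.NT} {v : List (Symbol T G.NT)}
    (h : G.Produces [Symbol.nonterminal A] v) : ContextFreeRule.mk A v ∈ G.rules := by
  obtain ⟨r, hr, h⟩ := h
  cases h with
  | head => simpa using hr
  | cons x h => cases h

/-- The induction is on the number of steps, because the derivations obtained by splitting are not
subterms of the given one. Their lengths add up to one less than its length. -/
theorem CountedDerivation.indexedDerivation (hG : IsChomskyNF G) {k n : ℕ} {A : G.NT}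
    {w : List T} (h : CountedDerivation G k n [Symbol.nonterminal A] w) :
    IndexedDerivation G k A w := by
  induction n using Nat.strong_induction_on generalizing k A w with
  | _ n ih =>
    generalize hu : [(Symbol.nonterminal A : Symbol T G.NT)] = u at h
    cases h with
    | refl w =>
      cases w with
      | nil => simp at hu
      | cons => simp at hu
    | @head n _ v _ step rest =>
      subst hu
      obtain ⟨hk, hv, step⟩ := step
      rw [nonterminalCount_nonterminal] at hk
      obtain ⟨k, rfl⟩ := Nat.exists_eq_add_of_le' hk
      have hr := produces_nonterminal step
      rcases hG _ hr with ⟨B, C, h⟩ | ⟨a, h⟩ | h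
      · obtain rfl : v = _ := h
        obtain ⟨n₁, n₂, w₁, w₂, rfl, rfl, h₁, h₂, h⟩ :=
          split (p := [Symbol.nonterminal B]) (q := [Symbol.nonterminal C]) rest
        rcases h (by rw [nonterminalCount_nonterminal])
          (by rw [nonterminalCount_nonterminal]) with h | h
        · exact .left hr (ih _ (by omega) h) (ih _ (by omega) h₂)
        · exact .right hr (ih _ (by omega) h₁) (ih _ (by omega) h)
      · obtain rfl : v = _ := h
        obtain rfl := eq_of_terminals (w' := [a]) rest
        exact .leaf hr
      · obtain rfl : v = _ := h
        obtain rfl := eq_of_terminals (w' := []) rest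
        exact .nil hr

theorem mem_approximation_iff (hG : IsChomskyNF G) {k : ℕ} {w : List T} :
    w ∈ approximation G k ↔ IndexedDerivation G k G.initial w :=
  ⟨fun h => (exists_countedDerivation h).choose_spec.indexedDerivation hG,
    fun h => h.boundedDerivation⟩

end BoundedDerivations

/-! ### Firing sequences -/

section Runs

variable {X : Type*} {d : ℕ} {N : PetriNet X d}

theorem PetriNet.Run.append {a m b : Fin d → ℕ} {u w : List X} (h₁ : N.Run a u m)
    (h₂ : N.Run m w b) : N.Run a (u ++ w) b := by
  induction h₁ with
  | nil => exact h₂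
  | cons mem fire _ ih =>
    rw [List.append_assoc]
    exact .cons mem fire (ih h₂)

theorem PetriNet.Run.exists_of_append {a b : Fin d → ℕ} {u w : List X}
    (h : N.Run a (u ++ w) b) : ∃ m, N.Run a u m ∧ N.Run m w b := by
  generalize hv : u ++ w = v at h
  induction h generalizing u with
  | nil μ =>
    obtain ⟨rfl, rfl⟩ := List.append_eq_nil_iff.1 hv
    exact ⟨μ, .nil μ, .nil μ⟩
  | @cons μ μ₁ μ' x ν v mem fire rest ih =>
    cases x with
    | none =>
      obtain ⟨m, h₁, h₂⟩ := ih hv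
      exact ⟨m, .cons mem fire h₁, h₂⟩
    | some x =>
      cases u with
      | nil =>
        simp only [List.nil_append] at hv
        subst hv
        exact ⟨μ, .nil μ, .cons mem fire rest⟩
      | cons y u =>
        simp only [Option.toList_some, List.cons_append, List.nil_append,
          List.cons.injEq] at hv
        obtain ⟨rfl, hv⟩ := hv
        obtain ⟨m, h₁, h₂⟩ := ih hv
        exact ⟨m, .cons mem fire h₁, h₂⟩

/-- A silent move of a Petri net. -/
def PetriNet.SilentStep (N : PetriNet X d) (a b : Fin d → ℕ) : Prop :=
  ∃ ν, (none, ν) ∈ N.transitions ∧ ∀ i, (b i : ℤ) = a i + ν i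

theorem PetriNet.run_nil_iff {a b : Fin d → ℕ} :
    N.Run a [] b ↔ Relation.ReflTransGen N.SilentStep a b := by
  constructor
  · intro h
    generalize hv : ([] : List X) = v at h
    induction h with
    | nil => exact .refl
    | @cons μ μ₁ μ' x ν v mem fire rest ih =>
      cases x with
      | none => exact .head ⟨ν, mem, fire⟩ (ih hv)
      | some x => simp at hv
  · intro h
    induction h using Relation.ReflTransGen.head_induction_on with
    | refl => exact .nil _
    | head h _ ih => exact .cons h.choose_spec.1 h.choose_spec.2 ih

theorem PetriNet.run_singleton_iff {a b : Fin d → ℕ} {x : X} :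
    N.Run a [x] b ↔ ∃ m m' ν, Relation.ReflTransGen N.SilentStep a m ∧
      (some x, ν) ∈ N.transitions ∧ (∀ i, (m' i : ℤ) = m i + ν i) ∧
      Relation.ReflTransGen N.SilentStep m' b := by
  constructor
  · intro h
    generalize hv : [x] = v at h
    induction h with
    | nil => simp at hv
    | @cons μ μ₁ μ' y ν v mem fire rest ih =>
      cases y with
      | none =>
        obtain ⟨m, m', ν', h₁, h₂, h₃, h₄⟩ := ih hv
        exact ⟨m, m', ν', .head ⟨ν, mem, fire⟩ h₁, h₂, h₃, h₄⟩
      | some y =>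
        simp only [Option.toList_some, List.cons_append, List.nil_append,
          List.cons.injEq] at hv
        obtain ⟨rfl, rfl⟩ := hv
        exact ⟨μ, μ₁, ν, .refl, mem, fire, run_nil_iff.1 rest⟩
  · rintro ⟨m, m', ν, h₁, h₂, h₃, h₄⟩
    exact Run.append (run_nil_iff.2 h₁) (.cons h₂ h₃ (run_nil_iff.2 h₄))

end Runs

/-! ### Derivations along firing sequences -/

/-- The data of a grammar in Chomsky normal form and a Petri net that read the same letters.
`nils` and `bins` are the productions without terminals, `leaves` joins the terminal productions
with the transitions for that letter and the image of the letter, and `silent` lists the effects of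
the silent transitions. -/
structure NetGrammar (N Y : Type) where
  dim : ℕ
  index : ℕ
  start : N
  nils : List N
  leaves : List (N × List Y × List ℤ)
  bins : List (N × N × N)
  silent : List (List ℤ)
  initMarking : List ℕ
  final : List (List ℕ)

namespace NetGrammar

variable {N Y : Type} (S : NetGrammar N Y)

/-- The addition of a vector to a marking. -/
def Fire (ν : List ℤ) (a b : Fin S.dim → ℕ) : Prop :=
  ∀ i, (b i : ℤ) = a i + vectorOfList S.dim ν i

/-- Sequences of silent moves. -/
def Silent : (Fin S.dim → ℕ) → (Fin S.dim → ℕ) → Prop :=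
  Relation.ReflTransGen fun a b => ∃ ν ∈ S.silent, S.Fire ν a b

/-- `S.Der l A a b v`: some word with a derivation of index `l` from `A` leads from marking `a`
to marking `b`, and its image has the letters `v`. -/
inductive Der : ℕ → N → (Fin S.dim → ℕ) → (Fin S.dim → ℕ) → Multiset Y → Prop
  | nil {l : ℕ} {A : N} {a b : Fin S.dim → ℕ} (mem : A ∈ S.nils) (h : S.Silent a b) :
      Der (l + 1) A a b 0
  | leaf {l : ℕ} {A : N} {u : List Y} {ν : List ℤ} {a m m' b : Fin S.dim → ℕ}
      (mem : (A, u, ν) ∈ S.leaves) (h₁ : S.Silent a m) (fire : S.Fire ν m m')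
      (h₂ : S.Silent m' b) : Der (l + 1) A a b u
  | right {l : ℕ} {A B C : N} {a m b : Fin S.dim → ℕ} {v v' : Multiset Y}
      (mem : (A, B, C) ∈ S.bins) (hB : Der (l + 1) B a m v) (hC : Der l C m b v') :
      Der (l + 1) A a b (v + v')
  | left {l : ℕ} {A B C : N} {a m b : Fin S.dim → ℕ} {v v' : Multiset Y}
      (mem : (A, B, C) ∈ S.bins) (hB : Der l B a m v) (hC : Der (l + 1) C m b v') :
      Der (l + 1) A a b (v + v')

/-! ### Monotonicity and trailing silent moves -/

variable {S}

theorem Fire.add_left {ν : List ℤ} {a b : Fin S.dim → ℕ} (h : S.Fire ν a b)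
    (o : Fin S.dim → ℕ) : S.Fire ν (o + a) (o + b) := fun i => by
  have := h i
  simp only [Pi.add_apply, Nat.cast_add]
  omega

theorem Silent.add_left {a b : Fin S.dim → ℕ} (h : S.Silent a b) (o : Fin S.dim → ℕ) :
    S.Silent (o + a) (o + b) := by
  induction h with
  | refl => exact .refl
  | tail _ h ih =>
    obtain ⟨ν, hν, h⟩ := h
    exact ih.tail ⟨ν, hν, h.add_left o⟩

/-- Firing is only limited by nonnegativity, so additional tokens do no harm. This allows the
machine to apply a derivation to a part of a marking. -/
theorem Der.add_left {l : ℕ} {A : N} {a b : Fin S.dim → ℕ} {v : Multiset Y}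
    (h : S.Der l A a b v) (o : Fin S.dim → ℕ) : S.Der l A (o + a) (o + b) v := by
  induction h with
  | nil mem h => exact .nil mem (h.add_left o)
  | leaf mem h₁ fire h₂ => exact .leaf mem (h₁.add_left o) (fire.add_left o) (h₂.add_left o)
  | right mem _ _ hB hC => exact .right mem hB hC
  | left mem _ _ hB hC => exact .left mem hB hC

/-- The silent moves are absorbed by the rightmost leaf. Hence the machine may fire silent
transitions whenever a derivation is present, even one whose root is a binary production. -/
theorem Der.trans_silent {l : ℕ} {A : N} {a b b' : Fin S.dim → ℕ} {v : Multiset Y}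
    (h : S.Der l A a b v) (hb : S.Silent b b') : S.Der l A a b' v := by
  induction h with
  | nil mem h => exact .nil mem (h.trans hb)
  | leaf mem h₁ fire h₂ => exact .leaf mem h₁ fire (h₂.trans hb)
  | right mem hB _ _ hC => exact .right mem hB (hC hb)
  | left mem hB _ _ hC => exact .left mem hB (hC hb)

/-- The Parikh images (as multisets) that are described by `S`. -/
def images (S : NetGrammar N Y) : Set (Multiset Y) :=
  {v | ∃ f ∈ S.final,
    S.Der S.index S.start (vectorOfList S.dim S.initMarking) (vectorOfList S.dim f) v}

/-- `S` describes the intersection of a finite-index language with a Petri net language, and its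
image under `h`. -/
structure Represents {X : Type} (G : ContextFreeGrammar.{0} X) (S : NetGrammar G.NT Y)
    (P : PetriNet X S.dim) (h : X → List Y) : Prop where
  start : S.start = G.initial
  initMarking : vectorOfList S.dim S.initMarking = P.initial
  final : ∀ f, f ∈ P.final ↔ ∃ l ∈ S.final, vectorOfList S.dim l = f
  nils : ∀ A, A ∈ S.nils ↔ ContextFreeRule.mk A [] ∈ G.rules
  bins : ∀ A B C, (A, B, C) ∈ S.bins ↔
    ContextFreeRule.mk A [Symbol.nonterminal B, Symbol.nonterminal C] ∈ G.rules
  silent : ∀ ν, (none, ν) ∈ P.transitions ↔ ∃ l ∈ S.silent, vectorOfList S.dim l = ν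
  of_leaves : ∀ A u l, (A, u, l) ∈ S.leaves →
    ∃ x, ContextFreeRule.mk A [Symbol.terminal x] ∈ G.rules ∧
      (some x, vectorOfList S.dim l) ∈ P.transitions ∧ h x = u
  leaves : ∀ A x ν, ContextFreeRule.mk A [Symbol.terminal x] ∈ G.rules →
    (some x, ν) ∈ P.transitions → ∃ l, vectorOfList S.dim l = ν ∧ (A, h x, l) ∈ S.leaves

/-! ### Agreement with derivation trees and firing sequences -/

section Represents

variable {X : Type} {G : ContextFreeGrammar.{0} X} {S : NetGrammar G.NT Y}
  {P : PetriNet X S.dim} {h : X → List Y}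

theorem Represents.silent_iff (hS : S.Represents G P h) {a b : Fin S.dim → ℕ} :
    S.Silent a b ↔ Relation.ReflTransGen P.SilentStep a b := by
  have : P.SilentStep = fun a b => ∃ ν ∈ S.silent, S.Fire ν a b := by
    ext a b
    constructor
    · rintro ⟨ν, hν, hf⟩
      obtain ⟨l, hl, rfl⟩ := (hS.silent ν).1 hν
      exact ⟨l, hl, hf⟩
    · rintro ⟨l, hl, hf⟩
      exact ⟨_, (hS.silent _).2 ⟨l, hl, rfl⟩, hf⟩
  rw [this, Silent]

/-- At a binary node, cutting the firing sequence between the two factors of the word yields the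
intermediate marking `m` of `Der`. At a leaf, silent moves surround the only visible transition. -/
theorem Represents.der_iff (hS : S.Represents G P h) {l : ℕ} {A : G.NT}
    {a b : Fin S.dim → ℕ} {v : Multiset Y} :
    S.Der l A a b v ↔
      ∃ w, IndexedDerivation G l A w ∧ P.Run a w b ∧ (w.flatMap h : Multiset Y) = v := by
  constructor
  · intro hd
    induction hd with
    | nil mem hs =>
      exact ⟨[], .nil ((hS.nils _).1 mem), PetriNet.run_nil_iff.2 (hS.silent_iff.1 hs), by simp⟩
    | leaf mem h₁ fire h₂ =>
      obtain ⟨x, hx, ht, rfl⟩ := hS.of_leaves _ _ _ mem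
      exact ⟨[x], .leaf hx, PetriNet.run_singleton_iff.2 ⟨_, _, _, hS.silent_iff.1 h₁, ht, fire,
        hS.silent_iff.1 h₂⟩, by simp⟩
    | right mem _ _ hB hC =>
      obtain ⟨u, hu, hru, rfl⟩ := hB
      obtain ⟨w, hw, hrw, rfl⟩ := hC
      exact ⟨u ++ w, .right ((hS.bins _ _ _).1 mem) hu hw, hru.append hrw, by simp⟩
    | left mem _ _ hB hC =>
      obtain ⟨u, hu, hru, rfl⟩ := hB
      obtain ⟨w, hw, hrw, rfl⟩ := hC
      exact ⟨u ++ w, .left ((hS.bins _ _ _).1 mem) hu hw, hru.append hrw, by simp⟩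
  · rintro ⟨w, hw, hr, rfl⟩
    induction hw generalizing a b with
    | nil mem => exact .nil ((hS.nils _).2 mem) (hS.silent_iff.2 (PetriNet.run_nil_iff.1 hr))
    | leaf mem =>
      obtain ⟨m, m', ν, h₁, h₂, h₃, h₄⟩ := PetriNet.run_singleton_iff.1 hr
      obtain ⟨l, rfl, hl⟩ := hS.leaves _ _ _ mem h₂
      simpa using Der.leaf hl (hS.silent_iff.2 h₁) h₃ (hS.silent_iff.2 h₄)
    | right mem _ _ ihB ihC =>
      obtain ⟨m, h₁, h₂⟩ := hr.exists_of_append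
      rw [List.flatMap_append, ← Multiset.coe_add]
      exact .right ((hS.bins _ _ _).2 mem) (ihB h₁) (ihC h₂)
    | left mem _ _ ihB ihC =>
      obtain ⟨m, h₁, h₂⟩ := hr.exists_of_append
      rw [List.flatMap_append, ← Multiset.coe_add]
      exact .left ((hS.bins _ _ _).2 mem) (ihB h₁) (ihC h₂)

theorem Represents.mem_images_iff (hS : S.Represents G P h) (hG : IsChomskyNF G)
    {v : Multiset Y} : v ∈ S.images ↔
      ∃ w ∈ morphicIntersection h (approximation G S.index) P.language, (w : Multiset Y) = v := by
  constructor
  · rintro ⟨f, hf, hd⟩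
    obtain ⟨w, hw, hr, rfl⟩ := hS.der_iff.1 hd
    rw [hS.start] at hw
    rw [hS.initMarking] at hr
    exact ⟨_, ⟨w, (mem_approximation_iff hG).2 hw, ⟨_, (hS.final _).2 ⟨f, hf, rfl⟩, hr⟩, rfl⟩,
      rfl⟩
  · rintro ⟨_, ⟨w, hw, ⟨μ, hμ, hr⟩, rfl⟩, rfl⟩
    obtain ⟨f, hf, rfl⟩ := (hS.final _).1 hμ
    refine ⟨f, hf, hS.der_iff.2 ⟨w, ?_, ?_, rfl⟩⟩
    · rw [hS.start]
      exact (mem_approximation_iff hG).1 hw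
    · rw [hS.initMarking]
      exact hr

end Represents

end NetGrammar

/-! ### A structured counter machine

The counters are arranged in levels; each level has a left and a right marking. -/

namespace NetGrammar

variable {N Y : Type}

/-- A pending binary production `A → B C`. The flag tells whether the derivation from `B` is
present and the one from `C` is being computed (`true`), or vice versa. -/
abbrev Pending (N : Type) := Bool × N × N × N

/-- The nonterminal of a pending production whose derivation is present. -/
def spine (p : Pending N) : N := cond p.1 p.2.2.1 p.2.2.2

/-- The nonterminal of a pending production whose derivation is being computed. -/
def callee (p : Pending N) : N := cond p.1 p.2.2.2 p.2.2.1

/-- Control states: `none` is final; otherwise there is a mode and a stack of pending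
productions. In mode `inl none`, a derivation is started; in mode `inl (some A)`, a derivation
from `A` is present; modes `inr false` and `inr true` use a derivation for the topmost pending
production. -/
abbrev Control (N : Type) := Option ((Option N ⊕ Bool) × List (Pending N))

/-- The addition of a vector to each of two markings, which are given by level and side. If they
coincide, the first addition is made. -/
abbrev Op := (ℕ × Bool × List ℤ) × (ℕ × Bool × List ℤ)

/-- The edges of the structured machine: source, word, number of levels that are tested for zero,
operation, target. -/
abbrev Edge (N Y : Type) := Control N × List Y × ℕ × Op × Control N

/-- The value that is added to a counter. -/
def opVal (o : Op) (l : ℕ) (s : Bool) (i : ℕ) : ℤ :=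
  if l = o.1.1 ∧ s = o.1.2.1 then o.1.2.2.getD i 0
  else if l = o.2.1 ∧ s = o.2.2.1 then o.2.2.2.getD i 0
  else 0

/-- The operation without effect. -/
def noOp : Op := ((0, false, []), (0, false, []))

/-- The addition of `ν` to the right marking of level `l`. -/
def fireOp (l : ℕ) (ν : List ℤ) : Op := ((l, true, ν), (l, true, ν))

/-- A multiple of a unit vector. -/
def unitList (i : ℕ) (z : ℤ) : List ℤ := (List.range i).map (fun _ => 0) ++ [z]

/-- The negative of a marking. -/
def negList (l : List ℕ) : List ℤ := l.map fun n : ℕ => -(n : ℤ)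

/-- The first phase of the application of a derivation. -/
def takeOp (l : ℕ) (s : Bool) (i : ℕ) : Op :=
  ((l, !s, unitList i (-1)), (l + 1, s, unitList i (-1)))

/-- The second phase of the application of a derivation. -/
def putOp (l : ℕ) (s : Bool) (i : ℕ) : Op :=
  ((l, s, unitList i (-1)), (l + 1, s, unitList i 1))

/-- Simultaneous increments on both sides. -/
def guessOp (l : ℕ) (i : ℕ) : Op := ((l, false, unitList i 1), (l, true, unitList i 1))

variable (S : NetGrammar N Y)

/-- All pending productions. -/
def pendings : List (Pending N) := S.bins.flatMap fun b => [(true, b), (false, b)]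

/-- All stacks of a given height. -/
def pendingStacks : ℕ → List (List (Pending N)) := Nat.rec [[]] fun _ L =>
  S.pendings.flatMap fun p => L.map fun r => p :: r

/-- The edges at level `l` below which lies the stack `r`. -/
def localEdges (l : ℕ) (r : List (Pending N)) : List (Edge N Y) :=
  ((List.range S.dim).map fun i =>
    (some (.inl none, r), [], 0, guessOp l i, some (.inl none, r))) ++
  ((S.silent.map fun ν => (some (.inl none, r), [], 0, fireOp l ν, some (.inl none, r))) ++
  ((S.leaves.flatMap fun e => S.silent.map fun ν =>
    (some (.inl (some e.1), r), [], 0, fireOp l ν, some (.inl (some e.1), r))) ++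
  ((S.nils.map fun A => (some (.inl none, r), [], 0, noOp, some (.inl (some A), r))) ++
  (S.leaves.map fun e =>
    (some (.inl none, r), e.2.1, 0, fireOp l e.2.2, some (.inl (some e.1), r))))))

/-- The edges between level `l + 1`, below which lies the stack `r`, and level `l`, for the
pending production `p`. -/
def callEdges (l : ℕ) (p : Pending N) (r : List (Pending N)) : List (Edge N Y) :=
  [(some (.inl (some (spine p)), r), [], 0, noOp, some (.inl none, p :: r)),
    (some (.inl (some (callee p)), p :: r), [], 0, noOp, some (.inr false, p :: r)),
    (some (.inr false, p :: r), [], 0, noOp, some (.inr true, p :: r)),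
    (some (.inr true, p :: r), [], l + 1, noOp, some (.inl (some p.2.1), r))] ++
  (((List.range S.dim).map fun i =>
    (some (.inr false, p :: r), [], 0, takeOp l p.1 i, some (.inr false, p :: r))) ++
  ((List.range S.dim).map fun i =>
    (some (.inr true, p :: r), [], 0, putOp l p.1 i, some (.inr true, p :: r))))

/-- The edges to the final state. -/
def finalEdges : List (Edge N Y) :=
  S.final.map fun f => (some (.inl (some S.start), []), [], 0,
    ((S.index - 1, false, negList S.initMarking), (S.index - 1, true, negList f)), none)

/-- All edges of the structured machine. -/
def edges : List (Edge N Y) :=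
  ((List.range S.index).flatMap fun m => (S.pendingStacks m).flatMap fun r =>
    S.localEdges (S.index - 1 - m) r) ++
  (((List.range (S.index - 1)).flatMap fun m => (S.pendingStacks m).flatMap fun r =>
    S.pendings.flatMap fun p => S.callEdges (S.index - 2 - m) p r) ++ S.finalEdges)

variable {S}

theorem mem_pendings {p : Pending N} : p ∈ S.pendings ↔ p.2 ∈ S.bins := by
  obtain ⟨s, b⟩ := p
  cases s <;> simp [pendings]

theorem mem_pendingStacks {m : ℕ} {r : List (Pending N)} :
    r ∈ S.pendingStacks m ↔ r.length = m ∧ ∀ p ∈ r, p.2 ∈ S.bins := by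
  induction m generalizing r with
  | zero =>
    rw [List.length_eq_zero_iff]
    have : S.pendingStacks 0 = [[]] := rfl
    rw [this, List.mem_singleton]
    exact ⟨fun h => ⟨h, by simp [h]⟩, fun h => h.1⟩
  | succ m ih =>
    have : S.pendingStacks (m + 1) = S.pendings.flatMap fun p => (S.pendingStacks m).map fun r => p :: r := rfl
    rw [this]
    simp only [List.mem_flatMap, List.mem_map, mem_pendings, ih]
    cases r with
    | nil => simp
    | cons p r =>
      simp only [List.cons.injEq, exists_eq_right_right, List.length_cons, add_left_inj,
        List.mem_cons, forall_eq_or_imp]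
      tauto

/-- The edges of the structured machine, by their purpose. -/
inductive IsEdge (S : NetGrammar N Y) : Edge N Y → Prop
  | guess {l i : ℕ} {r : List (Pending N)} (hr : ∀ p ∈ r, p.2 ∈ S.bins)
      (hl : l + r.length + 1 = S.index) (hi : i < S.dim) :
      IsEdge S (some (.inl none, r), [], 0, guessOp l i, some (.inl none, r))
  | silent_idle {l : ℕ} {r : List (Pending N)} {ν : List ℤ} (hr : ∀ p ∈ r, p.2 ∈ S.bins)
      (hl : l + r.length + 1 = S.index) (hν : ν ∈ S.silent) :
      IsEdge S (some (.inl none, r), [], 0, fireOp l ν, some (.inl none, r))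
  | silent {l : ℕ} {r : List (Pending N)} {ν : List ℤ} {e : N × List Y × List ℤ}
      (hr : ∀ p ∈ r, p.2 ∈ S.bins) (hl : l + r.length + 1 = S.index) (hν : ν ∈ S.silent)
      (he : e ∈ S.leaves) :
      IsEdge S (some (.inl (some e.1), r), [], 0, fireOp l ν, some (.inl (some e.1), r))
  | nil {l : ℕ} {r : List (Pending N)} {A : N} (hr : ∀ p ∈ r, p.2 ∈ S.bins)
      (hl : l + r.length + 1 = S.index) (hA : A ∈ S.nils) :
      IsEdge S (some (.inl none, r), [], 0, noOp, some (.inl (some A), r))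
  | leaf {l : ℕ} {r : List (Pending N)} {e : N × List Y × List ℤ}
      (hr : ∀ p ∈ r, p.2 ∈ S.bins) (hl : l + r.length + 1 = S.index) (he : e ∈ S.leaves) :
      IsEdge S (some (.inl none, r), e.2.1, 0, fireOp l e.2.2, some (.inl (some e.1), r))
  | call {l : ℕ} {r : List (Pending N)} {p : Pending N} {e : Edge N Y}
      (hr : ∀ p ∈ r, p.2 ∈ S.bins) (hl : l + r.length + 2 = S.index) (hp : p.2 ∈ S.bins)
      (he : e ∈ S.callEdges l p r) : IsEdge S e
  | final {f : List ℕ} (hf : f ∈ S.final) :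
      IsEdge S (some (.inl (some S.start), []), [], 0,
        ((S.index - 1, false, negList S.initMarking), (S.index - 1, true, negList f)), none)

/-- The list form serves finiteness and computability, the inductive form case distinctions. The
level is determined by the height of the stack, since both add up to `S.index - 1`. -/
theorem mem_edges {e : Edge N Y} : e ∈ S.edges ↔ S.IsEdge e := by
  constructor
  · intro h
    simp only [edges, List.mem_append, List.mem_flatMap, List.mem_range, mem_pendingStacks] at h
    rcases h with ⟨m, hm, r, ⟨rfl, hr⟩, h⟩ | ⟨m, hm, r, ⟨rfl, hr⟩, p, hp, h⟩ | h
    · have hl : S.index - 1 - r.length + r.length + 1 = S.index := by omega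
      simp only [localEdges, List.mem_append, List.mem_map, List.mem_range,
        List.mem_flatMap] at h
      rcases h with ⟨i, hi, rfl⟩ | ⟨ν, hν, rfl⟩ | ⟨e, he, ν, hν, rfl⟩ | ⟨A, hA, rfl⟩ | ⟨e, he, rfl⟩
      · exact .guess hr hl hi
      · exact .silent_idle hr hl hν
      · exact .silent hr hl hν he
      · exact .nil hr hl hA
      · exact .leaf hr hl he
    · exact .call hr (by omega) (mem_pendings.1 hp) h
    · simp only [finalEdges, List.mem_map] at h
      obtain ⟨f, hf, rfl⟩ := h
      exact .final hf
  · intro h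
    simp only [edges, List.mem_append, List.mem_flatMap, List.mem_range, mem_pendingStacks]
    cases h with
    | @guess l i r hr hl hi =>
      obtain rfl : l = S.index - 1 - r.length := by omega
      refine .inl ⟨_, by omega, r, ⟨rfl, hr⟩, ?_⟩
      simp only [localEdges, List.mem_append]
      exact .inl (List.mem_map.2 ⟨i, List.mem_range.2 hi, rfl⟩)
    | @silent_idle l r ν hr hl hν =>
      obtain rfl : l = S.index - 1 - r.length := by omega
      refine .inl ⟨_, by omega, r, ⟨rfl, hr⟩, ?_⟩
      simp only [localEdges, List.mem_append]
      exact .inr (.inl (List.mem_map.2 ⟨ν, hν, rfl⟩))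
    | @silent l r ν e hr hl hν he =>
      obtain rfl : l = S.index - 1 - r.length := by omega
      refine .inl ⟨_, by omega, r, ⟨rfl, hr⟩, ?_⟩
      simp only [localEdges, List.mem_append]
      exact .inr (.inr (.inl (List.mem_flatMap.2 ⟨e, he, List.mem_map.2 ⟨ν, hν, rfl⟩⟩)))
    | @nil l r A hr hl hA =>
      obtain rfl : l = S.index - 1 - r.length := by omega
      refine .inl ⟨_, by omega, r, ⟨rfl, hr⟩, ?_⟩
      simp only [localEdges, List.mem_append]
      exact .inr (.inr (.inr (.inl (List.mem_map.2 ⟨A, hA, rfl⟩))))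
    | @leaf l r e hr hl he =>
      obtain rfl : l = S.index - 1 - r.length := by omega
      refine .inl ⟨_, by omega, r, ⟨rfl, hr⟩, ?_⟩
      simp only [localEdges, List.mem_append]
      exact .inr (.inr (.inr (.inr (List.mem_map.2 ⟨e, he, rfl⟩))))
    | @call l r p e hr hl hp he =>
      obtain rfl : l = S.index - 2 - r.length := by omega
      exact .inr (.inl ⟨_, by omega, r, ⟨rfl, hr⟩, p, mem_pendings.2 hp, he⟩)
    | @final f hf =>
      exact .inr (.inr (List.mem_map.2 ⟨f, hf, rfl⟩))

/-- Counter values, by level, side and coordinate. -/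
abbrev Counters (S : NetGrammar N Y) := ℕ → Bool → Fin S.dim → ℕ

/-- Runs of the structured machine, with the letters that are read. -/
inductive MRun (S : NetGrammar N Y) :
    Control N → S.Counters → Multiset Y → Control N → S.Counters → Prop
  | refl (p : Control N) (c : S.Counters) : MRun S p c 0 p c
  | head {p p₁ q : Control N} {c c₁ c' : S.Counters} {u : List Y} {v : Multiset Y} {j : ℕ}
      {o : Op} (mem : (p, u, j, o, p₁) ∈ S.edges) (test : ∀ l < j, c l = 0)
      (add : ∀ l s i, (c₁ l s i : ℤ) = c l s i + opVal o l s i)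
      (rest : MRun S p₁ c₁ v q c') : MRun S p c (u + v) q c'

theorem MRun.trans {p q r : Control N} {c c' c'' : S.Counters} {v v' : Multiset Y}
    (h : S.MRun p c v q c') (h' : S.MRun q c' v' r c'') : S.MRun p c (v + v') r c'' := by
  induction h with
  | refl => simpa using h'
  | head mem test add _ ih =>
    rw [add_assoc]
    exact .head mem test add (ih h')

theorem MRun.single {p q : Control N} {c c' : S.Counters} {u : List Y} {j : ℕ} {o : Op}
    (mem : S.IsEdge (p, u, j, o, q)) (test : ∀ l < j, c l = 0)
    (add : ∀ l s i, (c' l s i : ℤ) = c l s i + opVal o l s i) : S.MRun p c u q c' := by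
  simpa using MRun.head (mem_edges.2 mem) test add (.refl q c')

theorem opVal_noOp (l : ℕ) (s : Bool) (i : ℕ) : opVal noOp l s i = 0 := by
  simp [opVal, noOp]

/-- Both components of `fireOp` address the same marking, so `opVal` uses the first one only and `ν`
is added once. -/
theorem opVal_fireOp (l' : ℕ) (ν : List ℤ) (l : ℕ) (s : Bool) (i : Fin S.dim) :
    opVal (fireOp l' ν) l s i = if l = l' ∧ s = true then vectorOfList S.dim ν i else 0 := by
  simp only [opVal, fireOp, vectorOfList]
  split_ifs with h
  · simp [h]
  · simp [h]

theorem getD_unitList (i j : ℕ) (z : ℤ) : (unitList i z).getD j 0 = if j = i then z else 0 := by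
  rw [unitList, List.getD_eq_getElem?_getD, List.getElem?_append]
  split_ifs with h₁ h₂ h₂
  · simp at h₁
    omega
  · simp at h₁
    simp [h₁]
  · simp [h₂]
  · rw [List.getElem?_singleton, if_neg]
    · rfl
    · simp at h₁ ⊢
      omega

theorem vectorOfList_negList (d : ℕ) (l : List ℕ) (i : Fin d) :
    vectorOfList d (negList l) i = -((vectorOfList d l i : ℕ) : ℤ) := by
  simp only [vectorOfList, negList, List.getD_eq_getElem?_getD, List.getElem?_map]
  cases l[(i : ℕ)]? <;> simp

theorem eq_of_add_noOp {c c' : S.Counters}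
    (h : ∀ l s i, (c' l s i : ℤ) = c l s i + opVal noOp l s i) : c' = c := by
  funext l s i
  have := h l s i
  rw [opVal_noOp] at this
  omega

theorem MRun.noOp {p q : Control N} {c : S.Counters} {j : ℕ}
    (mem : S.IsEdge (p, [], j, noOp, q)) (test : ∀ l < j, c l = 0) : S.MRun p c 0 q c :=
  MRun.single (u := []) mem test fun l s i => by rw [opVal_noOp, add_zero]

end NetGrammar

namespace NetGrammar

variable {N Y : Type} {S : NetGrammar N Y}

/-! ### Soundness of the structured machine -/

/-- A derivation between the two markings of a level. -/
def LevelDer (S : NetGrammar N Y) (l : ℕ) (A : N) (x : Bool → Fin S.dim → ℕ)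
    (v : Multiset Y) : Prop :=
  S.Der l A (x false) (x true) v

/-- The levels from `l` on hold the derivations of the pending productions. -/
def StackInv (S : NetGrammar N Y) :
    List (Pending N) → ℕ → S.Counters → Multiset Y → Prop
  | [], _, _, v => v = 0
  | p :: r, l, c, v => ∃ v₁ v₂, v = v₁ + v₂ ∧ p.2 ∈ S.bins ∧
      S.LevelDer (l + 1) (spine p) (c l) v₁ ∧ StackInv S r (l + 1) c v₂

/-- The meaning of the modes, at level `l`. -/
def ModeInv (S : NetGrammar N Y) :
    Option N ⊕ Bool → List (Pending N) → ℕ → S.Counters → Multiset Y → Prop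
  | .inl none, r, l, c, v => S.Silent (c l false) (c l true) ∧ S.StackInv r (l + 1) c v
  | .inl (some A), r, l, c, v => ∃ v₁ v₂, v = v₁ + v₂ ∧ S.LevelDer (l + 1) A (c l) v₁ ∧
      S.StackInv r (l + 1) c v₂
  | .inr _, [], _, _, _ => False
  | .inr b, p :: r, l, c, v => ∃ (x y o : Fin S.dim → ℕ) (v₁ v₂ v₃ : Multiset Y),
      (b = false → y = 0) ∧ v = v₁ + v₂ + v₃ ∧ p.2 ∈ S.bins ∧
      S.LevelDer (l + 1) (callee p) (fun s => c l s + if s = p.1 then y else x) v₁ ∧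
      S.LevelDer (l + 2) (spine p) (fun s => if s = p.1 then o + x else c (l + 1) s) v₂ ∧
      c (l + 1) p.1 = o + y ∧ S.StackInv r (l + 2) c v₃

/-- The invariant of the structured machine. -/
def Inv (S : NetGrammar N Y) : Control N → S.Counters → Multiset Y → Prop
  | none, c, v => ∃ f ∈ S.final, S.Der S.index S.start
      (c (S.index - 1) false + vectorOfList S.dim S.initMarking)
      (c (S.index - 1) true + vectorOfList S.dim f) v
  | some (t, r), c, v => ∃ l, l + r.length + 1 = S.index ∧ (∀ l' < l, c l' = 0) ∧
      S.ModeInv t r l c v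

/-- Work below level `l` cannot disturb the derivations of the pending productions. -/
theorem StackInv.congr {r : List (Pending N)} {l : ℕ} {c c' : S.Counters} {v : Multiset Y}
    (h : S.StackInv r l c v) (hc : ∀ l', l ≤ l' → c' l' = c l') : S.StackInv r l c' v := by
  induction r generalizing l v with
  | nil => exact h
  | cons p r ih =>
    obtain ⟨v₁, v₂, rfl, hp, hd, h⟩ := h
    exact ⟨v₁, v₂, rfl, hp, by rwa [hc l le_rfl], ih h fun l' hl => hc l' (by omega)⟩

theorem opVal_of_ne {o : Op} {l : ℕ} {s : Bool} (h₁ : l ≠ o.1.1) (h₂ : l ≠ o.2.1) (i : ℕ) :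
    opVal o l s i = 0 := by
  simp [opVal, h₁, h₂]

theorem eq_of_opVal_of_ne {o : Op} {c c' : S.Counters} {l : ℕ}
    (add : ∀ l s i, (c' l s i : ℤ) = c l s i + opVal o l s i) (h₁ : l ≠ o.1.1)
    (h₂ : l ≠ o.2.1) : c' l = c l := by
  funext s i
  have := add l s i
  rw [opVal_of_ne h₁ h₂] at this
  omega

theorem fire_of_fireOp {c c' : S.Counters} {l : ℕ} {ν : List ℤ}
    (add : ∀ l' s i, (c' l' s i : ℤ) = c l' s i + opVal (fireOp l ν) l' s i) :
    S.Fire ν (c l true) (c' l true) ∧ c' l false = c l false ∧ ∀ l' ≠ l, c' l' = c l' := by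
  refine ⟨fun i => ?_, ?_, fun l' h => eq_of_opVal_of_ne add h h⟩
  · have := add l true i
    rw [opVal_fireOp] at this
    simpa using this
  · funext i
    have := add l false i
    rw [opVal_fireOp] at this
    simpa using this

/-- The unit vectors. -/
def unitVec (S : NetGrammar N Y) (i : ℕ) : Fin S.dim → ℕ := fun j => if (j : ℕ) = i then 1 else 0

theorem Silent.step {a b b' : Fin S.dim → ℕ} {ν : List ℤ} (h : S.Silent a b) (hν : ν ∈ S.silent)
    (hf : S.Fire ν b b') : S.Silent a b' := h.tail ⟨ν, hν, hf⟩

theorem silent_of_fire {b b' : Fin S.dim → ℕ} {ν : List ℤ} (hν : ν ∈ S.silent)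
    (hf : S.Fire ν b b') : S.Silent b b' := .single ⟨ν, hν, hf⟩

theorem of_guessOp {c c' : S.Counters} {l i : ℕ}
    (add : ∀ l' s i', (c' l' s i' : ℤ) = c l' s i' + opVal (guessOp l i) l' s i') :
    (∀ s, c' l s = S.unitVec i + c l s) ∧ ∀ l' ≠ l, c' l' = c l' := by
  refine ⟨fun s => ?_, fun l' h => eq_of_opVal_of_ne add h h⟩
  funext j
  have := add l s j
  simp only [opVal, guessOp, getD_unitList] at this
  simp only [Pi.add_apply, unitVec]
  cases s <;> simp at this <;> split_ifs at * <;> omega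

theorem of_takeOp {c c' : S.Counters} {l i : ℕ} {s : Bool}
    (add : ∀ l' s' i', (c' l' s' i' : ℤ) = c l' s' i' + opVal (takeOp l s i) l' s' i') :
    c l (!s) = c' l (!s) + S.unitVec i ∧ c' l s = c l s ∧
    c (l + 1) s = c' (l + 1) s + S.unitVec i ∧ c' (l + 1) (!s) = c (l + 1) (!s) ∧
    ∀ l', l' ≠ l → l' ≠ l + 1 → c' l' = c l' := by
  refine ⟨?_, ?_, ?_, ?_, fun l' h₁ h₂ => eq_of_opVal_of_ne add h₁ h₂⟩
  · funext j
    have := add l (!s) j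
    simp only [opVal, takeOp, getD_unitList] at this
    simp only [Pi.add_apply, unitVec]
    simp at this
    split_ifs at * <;> omega
  · funext j
    have := add l s j
    simp only [opVal, takeOp, getD_unitList] at this
    simp at this
    omega
  · funext j
    have := add (l + 1) s j
    simp only [opVal, takeOp, getD_unitList] at this
    simp only [Pi.add_apply, unitVec]
    simp at this
    split_ifs at * <;> omega
  · funext j
    have := add (l + 1) (!s) j
    simp only [opVal, takeOp, getD_unitList] at this
    simp at this
    omega

theorem of_putOp {c c' : S.Counters} {l i : ℕ} {s : Bool}
    (add : ∀ l' s' i', (c' l' s' i' : ℤ) = c l' s' i' + opVal (putOp l s i) l' s' i') :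
    c l s = c' l s + S.unitVec i ∧ c' l (!s) = c l (!s) ∧
    c' (l + 1) s = c (l + 1) s + S.unitVec i ∧ c' (l + 1) (!s) = c (l + 1) (!s) ∧
    ∀ l', l' ≠ l → l' ≠ l + 1 → c' l' = c l' := by
  refine ⟨?_, ?_, ?_, ?_, fun l' h₁ h₂ => eq_of_opVal_of_ne add h₁ h₂⟩
  · funext j
    have := add l s j
    simp only [opVal, putOp, getD_unitList] at this
    simp only [Pi.add_apply, unitVec]
    simp at this
    split_ifs at * <;> omega
  · funext j
    have := add l (!s) j
    simp only [opVal, putOp, getD_unitList] at this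
    simp at this
    omega
  · funext j
    have := add (l + 1) s j
    simp only [opVal, putOp, getD_unitList] at this
    simp only [Pi.add_apply, unitVec]
    simp at this
    split_ifs at * <;> omega
  · funext j
    have := add (l + 1) (!s) j
    simp only [opVal, putOp, getD_unitList] at this
    simp at this
    omega

theorem Inv.level {t : Option N ⊕ Bool} {r : List (Pending N)} {c : S.Counters}
    {v : Multiset Y} {l : ℕ} (h : S.Inv (some (t, r)) c v) (hl : l + r.length + 1 = S.index) :
    (∀ l' < l, c l' = 0) ∧ S.ModeInv t r l c v := by
  obtain ⟨l', hl', h⟩ := h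
  obtain rfl : l' = l := by omega
  exact h

/-- During an application, `x` is the part of the callee's marking already taken on side `!p.1`, `y`
is the part already put on side `p.1`, and `o` is what remains of the upper marking. Adding `x` and
`y` back recovers the callee's derivation as it was before the application, and `o + x` recovers the
upper marking. Taking and putting keep these reconstructed derivations fixed. -/
theorem Inv.callEdges {l : ℕ} {r : List (Pending N)} {p : Pending N} {x y : Control N}
    {u : List Y} {j : ℕ} {o : Op} {c c' : S.Counters} {v : Multiset Y}
    (hl : l + r.length + 2 = S.index) (hp : p.2 ∈ S.bins)
    (he : (x, u, j, o, y) ∈ S.callEdges l p r) (test : ∀ l < j, c l = 0)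
    (add : ∀ l s i, (c' l s i : ℤ) = c l s i + opVal o l s i) (h : S.Inv x c v) :
    S.Inv y c' (v + u) := by
  have hl' : l + (p :: r).length + 1 = S.index := by simpa [add_assoc] using hl
  have hl'' : l + 1 + r.length + 1 = S.index := by omega
  simp only [NetGrammar.callEdges, List.mem_append, List.mem_cons, List.mem_map,
    List.mem_range, List.not_mem_nil, or_false, Prod.mk.injEq] at he
  rcases he with (he | he | he | he) | ⟨i, -, he⟩ | ⟨i, -, he⟩
  · obtain ⟨rfl, rfl, rfl, rfl, rfl⟩ := he
    obtain rfl := eq_of_add_noOp add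
    obtain ⟨h₁, v₁, v₂, rfl, hd, h₂⟩ := h.level hl''
    -- The new level is still empty, so both of its markings are zero and the empty silent sequence
    -- joins them.
    refine ⟨l, hl', fun l' h => h₁ l' (by omega), ?_, ?_⟩
    · rw [h₁ l (by omega)]
      exact .refl
    · exact ⟨v₁, v₂, by simp, hp, hd, h₂⟩
  · obtain ⟨rfl, rfl, rfl, rfl, rfl⟩ := he
    obtain rfl := eq_of_add_noOp add
    obtain ⟨h₁, v₁, v₂, rfl, hd, v₃, v₄, rfl, -, hd', h₂⟩ := h.level hl'
    -- Nothing has been moved yet, so the remainder `o` is the whole upper marking on side `p.1`.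
    refine ⟨l, hl', h₁, 0, 0, c' (l + 1) p.1, v₁, v₃, v₄, fun _ => rfl, by simp [add_assoc], hp,
      by simpa using hd, ?_, by simp, h₂⟩
    convert hd' using 2 with s
    split_ifs with hs
    · simp [hs]
    · rfl
  · obtain ⟨rfl, rfl, rfl, rfl, rfl⟩ := he
    obtain rfl := eq_of_add_noOp add
    obtain ⟨h₁, x, y, o, v₁, v₂, v₃, -, rfl, h₂⟩ := h.level hl'
    exact ⟨l, hl', h₁, x, y, o, v₁, v₂, v₃, by simp, by simp, h₂⟩
  · obtain ⟨rfl, rfl, rfl, rfl, rfl⟩ := he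
    obtain rfl := eq_of_add_noOp add
    obtain ⟨h₁, x, y, o, v₁, v₂, v₃, -, rfl, -, hd₁, hd₂, hc, h₂⟩ := h.level hl'
    -- By the zero test the callee's derivation joins exactly `x` and `y`. A taking phase left too
    -- early would have left tokens on level `l`.
    refine ⟨l + 1, hl'', test, v₂ + v₁, v₃, by simp; abel, ?_, h₂⟩
    simp only [LevelDer, test l (by omega), Pi.zero_apply, zero_add] at hd₁ hd₂ ⊢
    obtain ⟨s, A, B, C⟩ := p
    cases s
    -- On the left side the callee is applied backwards: it leads from `y` to `x`, so after
    -- translation by `o` it ends where the spine began.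
    · simp only [callee, spine, cond_false, if_true, Bool.true_eq_false, if_false] at hd₁ hd₂ hc ⊢
      rw [hc, add_comm v₂]
      exact .left hp (hd₁.add_left o) hd₂
    · simp only [callee, spine, cond_true, if_true, Bool.false_eq_true, if_false] at hd₁ hd₂ hc ⊢
      rw [hc]
      exact .right hp hd₂ (hd₁.add_left o)
  · obtain ⟨rfl, rfl, rfl, rfl, rfl⟩ := he
    obtain ⟨h₁, x, y, o, v₁, v₂, v₃, hy, rfl, -, hd₁, hd₂, hc, h₂⟩ := h.level hl'
    obtain rfl := hy rfl
    obtain ⟨e₁, e₂, e₃, e₄, e₅⟩ := of_takeOp add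
    -- Since `y = 0` in this phase, the remainder `o` is always the current upper marking. The unit
    -- that it loses goes over to `x`.
    refine ⟨l, hl', fun l' h => by rw [e₅ l' (by omega) (by omega), h₁ l' h],
      x + S.unitVec i, 0, c' (l + 1) p.1, v₁, v₂, v₃, fun _ => rfl, by simp, hp, ?_, ?_,
      by simp, h₂.congr fun l' h => e₅ l' (by omega) (by omega)⟩
    · convert hd₁ using 2 with s
      split_ifs with hs
      · rw [hs, e₂]
      · obtain rfl : s = !p.1 := Bool.eq_not.2 hs
        rw [e₁]
        abel
    · convert hd₂ using 2 with s
      split_ifs with hs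
      · rw [add_zero] at hc
        rw [← hc, e₃]
        abel
      · obtain rfl : s = !p.1 := Bool.eq_not.2 hs
        rw [e₄]
  · obtain ⟨rfl, rfl, rfl, rfl, rfl⟩ := he
    obtain ⟨h₁, x, y, o, v₁, v₂, v₃, -, rfl, -, hd₁, hd₂, hc, h₂⟩ := h.level hl'
    obtain ⟨e₁, e₂, e₃, e₄, e₅⟩ := of_putOp add
    refine ⟨l, hl', fun l' h => by rw [e₅ l' (by omega) (by omega), h₁ l' h],
      x, y + S.unitVec i, o, v₁, v₂, v₃, by simp, by simp, hp, ?_, ?_,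
      by rw [e₃, hc, add_assoc], h₂.congr fun l' h => e₅ l' (by omega) (by omega)⟩
    · convert hd₁ using 2 with s
      split_ifs with hs
      · rw [hs, e₁]
        abel
      · obtain rfl : s = !p.1 := Bool.eq_not.2 hs
        rw [e₂]
    · convert hd₂ using 2 with s
      split_ifs with hs
      · rfl
      · obtain rfl : s = !p.1 := Bool.eq_not.2 hs
        rw [e₄]

theorem Inv.step (hk : 1 ≤ S.index) {x y : Control N} {u : List Y} {j : ℕ} {o : Op}
    {c c' : S.Counters} {v : Multiset Y} (he : S.IsEdge (x, u, j, o, y))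
    (test : ∀ l < j, c l = 0)
    (add : ∀ l s i, (c' l s i : ℤ) = c l s i + opVal o l s i) (h : S.Inv x c v) :
    S.Inv y c' (v + u) := by
  cases he with
  | @guess l i r hr hl hi =>
    obtain ⟨h₁, hs, h₂⟩ := h.level hl
    obtain ⟨e₁, e₂⟩ := of_guessOp add
    refine ⟨l, hl, fun l' h => by rw [e₂ l' (by omega), h₁ l' h], ?_, ?_⟩
    -- Guessing may continue after silent moves have been fired; these remain possible in the larger
    -- markings.
    · rw [e₁, e₁]
      exact hs.add_left _
    · simpa using h₂.congr fun l' h => e₂ l' (by omega)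
  | @silent_idle l r ν hr hl hν =>
    obtain ⟨h₁, hs, h₂⟩ := h.level hl
    obtain ⟨e₀, e₁, e₂⟩ := fire_of_fireOp add
    refine ⟨l, hl, fun l' h => by rw [e₂ l' (by omega), h₁ l' h], ?_, ?_⟩
    · rw [e₁]
      exact hs.step hν e₀
    · simpa using h₂.congr fun l' h => e₂ l' (by omega)
  | @silent l r ν e hr hl hν he =>
    obtain ⟨h₁, v₁, v₂, rfl, hd, h₂⟩ := h.level hl
    obtain ⟨e₀, e₁, e₂⟩ := fire_of_fireOp add
    refine ⟨l, hl, fun l' h => by rw [e₂ l' (by omega), h₁ l' h], v₁, v₂, by simp, ?_,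
      h₂.congr fun l' h => e₂ l' (by omega)⟩
    rw [LevelDer, e₁]
    exact Der.trans_silent hd (silent_of_fire hν e₀)
  | @nil l r A hr hl hA =>
    obtain rfl := eq_of_add_noOp add
    obtain ⟨h₁, hs, h₂⟩ := h.level hl
    exact ⟨l, hl, h₁, 0, v, by simp, .nil hA hs, h₂⟩
  | @leaf l r e hr hl he =>
    obtain ⟨h₁, hs, h₂⟩ := h.level hl
    obtain ⟨e₀, e₁, e₂⟩ := fire_of_fireOp add
    refine ⟨l, hl, fun l' h => by rw [e₂ l' (by omega), h₁ l' h], e.2.1, v, add_comm _ _, ?_,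
      h₂.congr fun l' h => e₂ l' (by omega)⟩
    rw [LevelDer, e₁]
    exact .leaf (by simpa using he) hs e₀ .refl
  | call hr hl hp he => exact h.callEdges hl hp he test add
  | @final f hf =>
    -- With an empty stack the machine is at the top level `S.index - 1`, which holds a derivation
    -- of the full index. The invariant of the final state adds back the two markings subtracted by
    -- the edge.
    obtain ⟨-, v₁, v₂, rfl, hd, rfl⟩ := h.level (l := S.index - 1)
      (by rw [List.length_nil]; omega)
    have hi : S.index - 1 + 1 = S.index := by omega
    rw [hi] at hd
    refine ⟨f, hf, ?_⟩
    simp only [LevelDer] at hd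
    convert hd using 1
    · funext i
      have := add (S.index - 1) false i
      have hv := vectorOfList_negList S.dim S.initMarking i
      simp only [opVal, vectorOfList] at this hv
      simp only [Pi.add_apply, vectorOfList]
      simp at this hv ⊢
      omega
    · funext i
      have := add (S.index - 1) true i
      have hv := vectorOfList_negList S.dim f i
      simp only [opVal, vectorOfList] at this hv
      simp only [Pi.add_apply, vectorOfList]
      simp at this hv ⊢
      omega
    · simp

theorem MRun.inv (hk : 1 ≤ S.index) {x y : Control N} {c c' : S.Counters} {v w : Multiset Y}
    (h : S.MRun x c w y c') (hi : S.Inv x c v) : S.Inv y c' (v + w) := by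
  induction h generalizing v with
  | refl => simpa using hi
  | head mem test add _ ih =>
    rw [← add_assoc]
    exact ih (hi.step hk (mem_edges.1 mem) test add)

/-! ### Completeness of the structured machine -/

/-- The counters with value `x` at one marking. -/
def block (S : NetGrammar N Y) (l : ℕ) (s : Bool) (x : Fin S.dim → ℕ) : S.Counters :=
  fun l' s' => if l' = l ∧ s' = s then x else 0

theorem block_zero (l : ℕ) (s : Bool) : S.block l s 0 = 0 := by
  funext l' s' i
  simp [block]

theorem block_add (l : ℕ) (s : Bool) (x y : Fin S.dim → ℕ) :
    S.block l s (x + y) = S.block l s x + S.block l s y := by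
  funext l' s' i
  simp only [block, Pi.add_apply]
  split_ifs <;> simp

theorem block_of_ne {l l' : ℕ} (h : l' ≠ l) (s : Bool) (x : Fin S.dim → ℕ) :
    S.block l s x l' = 0 := by
  funext s'
  simp [block, h]

/-- The machine moves vectors by one unit at a time, so its phases are analysed by induction on the
sum of the entries. -/
theorem vec_induction {P : (Fin S.dim → ℕ) → Prop} (h0 : P 0)
    (hs : ∀ (x : Fin S.dim → ℕ) (i : Fin S.dim), P x → P (x + S.unitVec i))
    (x : Fin S.dim → ℕ) : P x := by
  induction hn : ∑ i, x i generalizing x with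
  | zero =>
    convert h0
    funext i
    simpa using (Finset.sum_eq_zero_iff.1 hn) i (Finset.mem_univ i)
  | succ n ih =>
    obtain ⟨i, -, hi⟩ := Finset.exists_ne_zero_of_sum_ne_zero
      (by rw [hn]; omega : ∑ i, x i ≠ 0)
    have hx : x = (fun j => x j - S.unitVec i j) + S.unitVec i := by
      funext j
      simp only [Pi.add_apply, unitVec]
      split_ifs with h
      · obtain rfl := Fin.ext h
        omega
      · omega
    rw [hx]
    apply hs
    apply ih
    rw [hx] at hn
    simp only [Pi.add_apply, Finset.sum_add_distrib] at hn
    have : ∑ j, S.unitVec i j = 1 := by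
      simp [unitVec, ← Fin.ext_iff]
    omega

theorem mrun_guess {l : ℕ} {r : List (Pending N)} (hr : ∀ p ∈ r, p.2 ∈ S.bins)
    (hl : l + r.length + 1 = S.index) (c : S.Counters) (x : Fin S.dim → ℕ) :
    S.MRun (some (.inl none, r)) c 0 (some (.inl none, r))
      (c + S.block l false x + S.block l true x) := by
  induction x using vec_induction with
  | h0 =>
    simp only [block_zero, add_zero]
    exact .refl _ _
  | hs x i ih =>
    rw [← add_zero (0 : Multiset Y)]
    refine ih.trans (MRun.single (u := []) (.guess hr hl i.2) (by simp) fun l' s j => ?_)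
    simp only [block_add, Pi.add_apply, opVal, guessOp, getD_unitList]
    simp only [block]
    by_cases h : l' = l
    · cases s <;> simp [h, unitVec]
      all_goals split_ifs <;> omega
    · simp [h]

theorem mrun_silent {l : ℕ} {r : List (Pending N)} {t : Option N ⊕ Bool}
    (ht : ∀ ν ∈ S.silent, S.IsEdge (some (t, r), [], 0, fireOp l ν, some (t, r)))
    (c : S.Counters) {x y : Fin S.dim → ℕ} (h : S.Silent x y) :
    S.MRun (some (t, r)) (c + S.block l true x) 0 (some (t, r)) (c + S.block l true y) := by
  induction h with
  | refl => exact .refl _ _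
  | tail _ h ih =>
    obtain ⟨ν, hν, hf⟩ := h
    rw [← add_zero (0 : Multiset Y)]
    refine ih.trans (MRun.single (u := []) (ht ν hν) (by simp) fun l' s j => ?_)
    rw [opVal_fireOp]
    simp only [Pi.add_apply, block]
    split_ifs with hs
    · have := hf j
      push_cast
      omega
    · simp

theorem mrun_take {l : ℕ} {r : List (Pending N)} {p : Pending N}
    (hr : ∀ p ∈ r, p.2 ∈ S.bins) (hl : l + r.length + 2 = S.index) (hp : p.2 ∈ S.bins)
    (c : S.Counters) (x : Fin S.dim → ℕ) :
    S.MRun (some (.inr false, p :: r)) (c + S.block l (!p.1) x + S.block (l + 1) p.1 x) 0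
      (some (.inr false, p :: r)) c := by
  induction x using vec_induction with
  | h0 =>
    simp only [block_zero, add_zero]
    exact .refl _ _
  | hs x i ih =>
    rw [← add_zero (0 : Multiset Y)]
    have he : S.IsEdge (some (.inr false, p :: r), [], 0, takeOp l p.1 i,
        some (.inr false, p :: r)) := .call hr hl hp (by
          simp only [callEdges, List.mem_append]
          exact .inr (.inl (List.mem_map.2 ⟨i, List.mem_range.2 i.2, rfl⟩)))
    refine (MRun.single (u := []) he (by simp) fun l' s j => ?_).trans ih
    simp only [block_add, Pi.add_apply, opVal, takeOp, getD_unitList]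
    simp only [block]
    by_cases h₁ : l' = l
    · by_cases h : s = !p.1
      · simp [h₁, h, unitVec]
        split_ifs <;> omega
      · simp [h₁, h]
    · by_cases h : l' = l + 1 ∧ s = p.1
      · simp [h, unitVec]
        split_ifs <;> omega
      · simp [h₁, h]

theorem mrun_put {l : ℕ} {r : List (Pending N)} {p : Pending N}
    (hr : ∀ p ∈ r, p.2 ∈ S.bins) (hl : l + r.length + 2 = S.index) (hp : p.2 ∈ S.bins)
    (c : S.Counters) (x : Fin S.dim → ℕ) :
    S.MRun (some (.inr true, p :: r)) (c + S.block l p.1 x) 0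
      (some (.inr true, p :: r)) (c + S.block (l + 1) p.1 x) := by
  induction x using vec_induction generalizing c with
  | h0 =>
    simp only [block_zero, add_zero]
    exact .refl _ _
  | hs x i ih =>
    rw [← add_zero (0 : Multiset Y)]
    have he : S.IsEdge (some (.inr true, p :: r), [], 0, putOp l p.1 i,
        some (.inr true, p :: r)) := .call hr hl hp (by
          simp only [callEdges, List.mem_append]
          exact .inr (.inr (List.mem_map.2 ⟨i, List.mem_range.2 i.2, rfl⟩)))
    -- The unit that is moved first joins the fixed part `c` of the counters on level `l + 1`.
    have h := ih (c + S.block (l + 1) p.1 (S.unitVec i))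
    rw [add_assoc c (S.block (l + 1) p.1 _) (S.block (l + 1) p.1 _), ← block_add,
      add_comm _ x] at h
    refine (MRun.single (u := []) he (by simp) fun l' s j => ?_).trans h
    simp only [block_add, Pi.add_apply, opVal, putOp, getD_unitList]
    simp only [block]
    by_cases h₁ : l' = l ∧ s = p.1
    · simp [h₁, unitVec]
      split_ifs <;> omega
    · by_cases h : l' = l + 1 ∧ s = p.1
      · simp [h, unitVec]
      · simp [h₁, h]

theorem Der.index_pos {l : ℕ} {A : N} {a b : Fin S.dim → ℕ} {v : Multiset Y}
    (h : S.Der l A a b v) : 1 ≤ l := by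
  cases h <;> omega

/-- The application of a derivation to a pending production. -/
theorem mrun_apply {l : ℕ} {r : List (Pending N)} {p : Pending N}
    (hr : ∀ p ∈ r, p.2 ∈ S.bins) (hl : l + r.length + 2 = S.index) (hp : p.2 ∈ S.bins)
    (c : S.Counters) (hc : ∀ l' ≤ l, c l' = 0) (x y : Fin S.dim → ℕ) :
    S.MRun (some (.inl (some (callee p)), p :: r))
      (c + S.block (l + 1) p.1 x + S.block l (!p.1) x + S.block l p.1 y) 0
      (some (.inl (some p.2.1), r)) (c + S.block (l + 1) p.1 y) := by
  have h₁ := mrun_take hr hl hp (c + S.block l p.1 y) x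
  have h₂ := mrun_put hr hl hp c y
  have e₁ : S.IsEdge (some (.inl (some (callee p)), p :: r), [], 0, noOp,
      some (.inr false, p :: r)) := .call hr hl hp (by simp [callEdges])
  have e₂ : S.IsEdge (some (.inr false, p :: r), [], 0, noOp,
      some (.inr true, p :: r)) := .call hr hl hp (by simp [callEdges])
  have e₃ : S.IsEdge (some (.inr true, p :: r), [], l + 1, noOp,
      some (.inl (some p.2.1), r)) := .call hr hl hp (by simp [callEdges])
  have h := (MRun.noOp e₁ (by simp)).trans (h₁.trans ((MRun.noOp e₂ (by simp)).trans
    (h₂.trans (MRun.noOp e₃ fun l' hl' => ?_))))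
  · simp only [add_zero] at h
    convert h using 1
    abel
  · rw [Pi.add_apply, hc l' (by omega), block_of_ne (by omega), add_zero]

/-- The spine child is computed first on the same level, then the other child one level below, and
then the latter is applied. The levels above `l` are arbitrary because they hold the suspended
spines; those up to `l` must be empty for the zero tests of the applications. The index is a
variable `n` with an equation so that the level can change in the induction. -/
theorem Der.mrun {n : ℕ} {A : N} {a b : Fin S.dim → ℕ} {v : Multiset Y}
    (h : S.Der n A a b v) {l : ℕ} (hn : n = l + 1) {r : List (Pending N)}
    (hr : ∀ p ∈ r, p.2 ∈ S.bins) (hl : l + r.length + 1 = S.index) {c : S.Counters}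
    (hc : ∀ l' ≤ l, c l' = 0) :
    S.MRun (some (.inl none, r)) c v (some (.inl (some A), r))
      (c + S.block l false a + S.block l true b) := by
  induction h generalizing l r c with
  | @nil _ A a b mem h =>
    have h₁ := mrun_guess hr hl c a
    have h₂ := mrun_silent (fun ν hν => .silent_idle hr hl hν) (c + S.block l false a) h
    simpa using (h₁.trans h₂).trans (MRun.noOp (.nil hr hl mem) (by simp))
  | @leaf _ A u ν a m m' b mem h fire h' =>
    have h₁ := mrun_guess hr hl c a
    have h₂ := mrun_silent (fun ν hν => .silent_idle hr hl hν) (c + S.block l false a) h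
    have h₃ : S.MRun _ (c + S.block l false a + S.block l true m) u _
        (c + S.block l false a + S.block l true m') :=
      MRun.single (.leaf hr hl mem) (by simp) fun l' s j => by
        rw [opVal_fireOp]
        simp only [Pi.add_apply, block]
        have := fire j
        split_ifs <;> simp <;> omega
    have h₄ := mrun_silent (fun ν hν => .silent hr hl hν mem) (c + S.block l false a) h'
    simpa using (h₁.trans h₂).trans (h₃.trans h₄)
  | @right n A B C a m b v v' mem hB hC ihB ihC =>
    obtain rfl : n = l := by omega
    obtain ⟨l, rfl⟩ := Nat.exists_eq_add_of_le' hC.index_pos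
    have h₁ := ihB rfl hr hl hc
    have hl' : l + r.length + 2 = S.index := by omega
    have hp : ∀ p ∈ ((true, A, B, C) : Pending N) :: r, p.2 ∈ S.bins := by
      intro p h
      rcases List.mem_cons.1 h with rfl | h
      exacts [mem, hr p h]
    have e : S.IsEdge (some (.inl (some B), r), [], 0, noOp,
        some (.inl none, (true, A, B, C) :: r)) :=
      .call (p := (true, A, B, C)) hr hl' mem (by simp [callEdges, spine])
    have hc' : ∀ l' ≤ l, c l' = 0 := fun l' h => hc l' (by omega)
    have h₂ := ihC rfl hp (by rw [List.length_cons]; omega)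
      (c := c + S.block (l + 1) false a + S.block (l + 1) true m) fun l' h => by
        rw [Pi.add_apply, Pi.add_apply, hc' l' h, block_of_ne (by omega), block_of_ne (by omega)]
        rfl
    have h₃ := mrun_apply (p := (true, A, B, C)) hr hl' mem (c + S.block (l + 1) false a)
      (fun l' h => by
        rw [Pi.add_apply, hc' l' h, block_of_ne (by omega)]
        rfl) m b
    simpa using (h₁.trans (MRun.noOp e (by simp))).trans (h₂.trans h₃)
  | @left n A B C a m b v v' mem hB hC ihB ihC =>
    obtain rfl : n = l := by omega
    obtain ⟨l, rfl⟩ := Nat.exists_eq_add_of_le' hB.index_pos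
    have h₁ := ihC rfl hr hl hc
    have hl' : l + r.length + 2 = S.index := by omega
    have hp : ∀ p ∈ ((false, A, B, C) : Pending N) :: r, p.2 ∈ S.bins := by
      intro p h
      rcases List.mem_cons.1 h with rfl | h
      exacts [mem, hr p h]
    have e : S.IsEdge (some (.inl (some C), r), [], 0, noOp,
        some (.inl none, (false, A, B, C) :: r)) :=
      .call (p := (false, A, B, C)) hr hl' mem (by simp [callEdges, spine])
    have hc' : ∀ l' ≤ l, c l' = 0 := fun l' h => hc l' (by omega)
    have h₂ := ihB rfl hp (by rw [List.length_cons]; omega)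
      (c := c + S.block (l + 1) false m + S.block (l + 1) true b) fun l' h => by
        rw [Pi.add_apply, Pi.add_apply, hc' l' h, block_of_ne (by omega), block_of_ne (by omega)]
        rfl
    have h₃ := mrun_apply (p := (false, A, B, C)) hr hl' mem (c + S.block (l + 1) true b)
      (fun l' h => by
        rw [Pi.add_apply, hc' l' h, block_of_ne (by omega)]
        rfl) m a
    have e₁ : c + S.block (l + 1) true b + S.block (l + 1) false m + S.block l true m +
        S.block l false a = c + S.block (l + 1) false m + S.block (l + 1) true b +
        S.block l false a + S.block l true m := by abel
    have e₂ : c + S.block (l + 1) true b + S.block (l + 1) false a =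
        c + S.block (l + 1) false a + S.block (l + 1) true b := by abel
    simp only [Bool.not_false, e₁, e₂] at h₃
    -- The letters of `C` are read before those of `B`; only the multisets agree.
    rw [add_comm v]
    simpa using (h₁.trans (MRun.noOp e (by simp))).trans (h₂.trans h₃)

/-- The structured machine reads the letters that are described by the grammar and the net. -/
theorem mem_images_iff_mrun (hk : 1 ≤ S.index) {v : Multiset Y} :
    v ∈ S.images ↔ S.MRun (some (.inl none, [])) 0 v none 0 := by
  constructor
  · rintro ⟨f, hf, h⟩
    have h₁ := h.mrun (l := S.index - 1) (r := []) (c := 0) (by omega) (by simp)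
      (by rw [List.length_nil]; omega) (fun _ _ => rfl)
    have h₂ : S.MRun _ _ ([] : List Y) _ 0 := MRun.single (.final hf) (by simp)
      (c := 0 + S.block (S.index - 1) false (vectorOfList S.dim S.initMarking) +
        S.block (S.index - 1) true (vectorOfList S.dim f)) fun l s i => by
        have hv := vectorOfList_negList S.dim S.initMarking i
        have hv' := vectorOfList_negList S.dim f i
        simp only [vectorOfList] at hv hv'
        simp only [opVal, Pi.add_apply, block, Pi.zero_apply]
        rw [hv, hv']
        by_cases h : l = S.index - 1
        · cases s <;> simp [h, vectorOfList]
        · simp [h]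
    simpa using h₁.trans h₂
  · intro h
    -- The run starts at the top level, with the empty silent sequence from zero to zero. At its end
    -- all counters are zero, so the invariant yields the initial and final markings themselves.
    have h₀ : S.Inv (some (.inl none, [])) 0 0 :=
      ⟨S.index - 1, by rw [List.length_nil]; omega, fun _ _ => rfl, .refl, rfl⟩
    obtain ⟨f, hf, h⟩ := h.inv hk h₀
    exact ⟨f, hf, by simpa using h⟩

end NetGrammar

namespace NetGrammar

variable {N Y : Type} (S : NetGrammar N Y)

/-! ### From the structured machine to priority machines -/

/-- The number of counters of the priority machine. -/
def numCounters : ℕ := S.index * (2 * S.dim)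

/-- The vector that belongs to an operation. -/
def opList (o : Op) : List ℤ := (List.range S.numCounters).map fun n =>
  opVal o (n / (2 * S.dim)) (n / S.dim).bodd (n % S.dim)

/-- The position of a counter. -/
def position (l : ℕ) (s : Bool) (i : Fin S.dim) : ℕ := (2 * l + s.toNat) * S.dim + i

/-- The control states that occur. -/
def controls : Set (Control N) :=
  {x | x = some (.inl none, []) ∨ x = none ∨ ∃ e ∈ S.edges, x = e.1 ∨ x = e.2.2.2.2}

variable {S}

theorem position_div (l : ℕ) (s : Bool) (i : Fin S.dim) :
    S.position l s i / S.dim = 2 * l + s.toNat := by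
  rw [position, mul_comm, Nat.mul_add_div (by have := i.2; omega), Nat.div_eq_of_lt i.2, add_zero]

theorem position_level (l : ℕ) (s : Bool) (i : Fin S.dim) :
    S.position l s i / (2 * S.dim) = l := by
  rw [mul_comm 2, ← Nat.div_div_eq_div_mul, position_div]
  cases s <;> simp
  omega

theorem position_side (l : ℕ) (s : Bool) (i : Fin S.dim) :
    (S.position l s i / S.dim).bodd = s := by
  rw [position_div]
  cases s <;> simp

theorem position_mod (l : ℕ) (s : Bool) (i : Fin S.dim) : S.position l s i % S.dim = i := by
  rw [position, mul_comm, Nat.mul_add_mod, Nat.mod_eq_of_lt i.2]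

/-- Levels occupy consecutive blocks of `2 * S.dim` counters in increasing order. Testing the lowest
`j` levels is therefore testing a prefix of the counters. -/
theorem position_lt {l j : ℕ} (h : l < j) (s : Bool) (i : Fin S.dim) :
    S.position l s i < j * (2 * S.dim) := by
  have h₁ : S.position l s i < (2 * l + s.toNat + 1) * S.dim := by
    rw [position, Nat.succ_mul (2 * l + s.toNat)]
    have := i.2
    omega
  have h₂ : (2 * l + s.toNat + 1) * S.dim ≤ (2 * j) * S.dim := by
    refine Nat.mul_le_mul_right _ ?_
    have := s.toNat_le
    omega
  calc _ < _ := h₁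
    _ ≤ _ := h₂
    _ = _ := by ring

theorem dim_pos (n : Fin S.numCounters) : 0 < S.dim := by
  rcases Nat.eq_zero_or_pos S.dim with h | h
  · have := n.2
    simp [numCounters, h] at this
  · exact h

/-- The counters of the priority machine, by level, side and coordinate. -/
def unflatten (S : NetGrammar N Y) (μ : Fin S.numCounters → ℕ) : S.Counters := fun l s i =>
  if h : l < S.index then μ ⟨S.position l s i, position_lt h s i⟩ else 0

/-- The inverse of `unflatten`. -/
def flatten (S : NetGrammar N Y) (c : S.Counters) : Fin S.numCounters → ℕ := fun n =>
  c (n / (2 * S.dim)) (n / S.dim : ℕ).bodd ⟨n % S.dim, Nat.mod_lt _ (dim_pos n)⟩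

theorem unflatten_zero : S.unflatten 0 = 0 := by
  funext l s i
  simp [unflatten]

theorem vectorOfList_opList (o : Op) (n : Fin S.numCounters) :
    vectorOfList S.numCounters (S.opList o) n =
      opVal o (n / (2 * S.dim)) (n / S.dim : ℕ).bodd (n % S.dim : ℕ) := by
  simp [vectorOfList, opList, n.2]

theorem vectorOfList_opList_position (o : Op) {l : ℕ} (h : l < S.index) (s : Bool)
    (i : Fin S.dim) : vectorOfList S.numCounters (S.opList o)
      ⟨S.position l s i, position_lt h s i⟩ = opVal o l s i := by
  rw [vectorOfList_opList]
  simp only [position_level, position_side, position_mod]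

/-- The first bound prevents the number of tested counters from being changed by the reduction
modulo `S.numCounters + 1`. The second shows that the levels from `S.index` on, which have no
counters in the priority machine, remain zero. -/
theorem IsEdge.bounds (hk : 1 ≤ S.index) {x y : Control N} {u : List Y} {j : ℕ} {o : Op}
    (h : S.IsEdge (x, u, j, o, y)) :
    j ≤ S.index ∧ ∀ l s i, S.index ≤ l → opVal o l s i = 0 := by
  cases h with
  | guess hr hl hi =>
    refine ⟨by omega, fun l s i h => opVal_of_ne ?_ ?_ i⟩ <;> simp only [guessOp] <;> omega
  | silent_idle hr hl =>
    refine ⟨by omega, fun l s i h => opVal_of_ne ?_ ?_ i⟩ <;> simp only [fireOp] <;> omega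
  | silent hr hl =>
    refine ⟨by omega, fun l s i h => opVal_of_ne ?_ ?_ i⟩ <;> simp only [fireOp] <;> omega
  | nil => exact ⟨by omega, fun l s i h => opVal_noOp l s i⟩
  | leaf hr hl =>
    refine ⟨by omega, fun l s i h => opVal_of_ne ?_ ?_ i⟩ <;> simp only [fireOp] <;> omega
  | @call l r p _ hr hl hp he =>
    simp only [callEdges, List.mem_append, List.mem_cons, List.mem_map,
      List.mem_range, List.not_mem_nil, or_false, Prod.mk.injEq] at he
    rcases he with (he | he | he | he) | ⟨i, -, he⟩ | ⟨i, -, he⟩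
    · obtain ⟨-, -, rfl, rfl, -⟩ := he
      exact ⟨by omega, fun l s i h => opVal_noOp l s i⟩
    · obtain ⟨-, -, rfl, rfl, -⟩ := he
      exact ⟨by omega, fun l s i h => opVal_noOp l s i⟩
    · obtain ⟨-, -, rfl, rfl, -⟩ := he
      exact ⟨by omega, fun l s i h => opVal_noOp l s i⟩
    · obtain ⟨-, -, rfl, rfl, -⟩ := he
      exact ⟨by omega, fun l s i h => opVal_noOp l s i⟩
    · obtain ⟨-, -, rfl, rfl, -⟩ := he
      refine ⟨by omega, fun l s i h => opVal_of_ne ?_ ?_ i⟩ <;> simp only [takeOp] <;> omega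
    · obtain ⟨-, -, rfl, rfl, -⟩ := he
      refine ⟨by omega, fun l s i h => opVal_of_ne ?_ ?_ i⟩ <;> simp only [putOp] <;> omega
  | final =>
    refine ⟨by omega, fun l s i h => opVal_of_ne ?_ ?_ i⟩ <;> simp only <;> omega

/-- `A` is the priority machine of `S`, with states renamed by `e`. -/
structure IsMachine (S : NetGrammar N Y) (A : PriorityMachine Y S.numCounters)
    (e : Control N → A.State) : Prop where
  start : A.start = e (some (.inl none, []))
  final : ∀ q, q ∈ A.final ↔ q = e none
  injOn : Set.InjOn e S.controls
  edges : ∀ x, x ∈ A.edges ↔ ∃ E ∈ S.edges, x = (e E.1, E.2.1,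
    Fin.ofNat (S.numCounters + 1) (E.2.2.1 * (2 * S.dim)),
    vectorOfList S.numCounters (S.opList E.2.2.2.1), e E.2.2.2.2)

/-! ### Simulation between structured and priority machines -/

section IsMachine

variable {A : PriorityMachine Y S.numCounters} {e : Control N → A.State}

theorem ofNat_test {j : ℕ} (hj : j ≤ S.index) :
    (Fin.ofNat (S.numCounters + 1) (j * (2 * S.dim)) : ℕ) = j * (2 * S.dim) := by
  rw [Fin.val_ofNat, Nat.mod_eq_of_lt]
  exact Nat.lt_succ_of_le (Nat.mul_le_mul_right _ hj)

/-- The renaming of states is injective only on the control states that occur, so the run is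
followed within these; there each machine edge determines its structured source. -/
theorem IsMachine.mrun_of_run (hA : S.IsMachine A e) (hk : 1 ≤ S.index) {x y : A.State}
    {μ μ' : Fin S.numCounters → ℕ} {w : List Y} (h : A.Run x μ w y μ') {p : Control N}
    (hp : p ∈ S.controls) (hx : x = e p) :
    ∃ q ∈ S.controls, y = e q ∧ S.MRun p (S.unflatten μ) w q (S.unflatten μ') := by
  induction h generalizing p with
  | nil x μ => exact ⟨p, hp, hx, .refl _ _⟩
  | @cons x x₁ y μ μ₁ μ' u w l ν mem test add rest ih =>
    obtain ⟨⟨p', u', j, o, q'⟩, hE, heq⟩ := (hA.edges _).1 mem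
    simp only [Prod.mk.injEq] at heq
    obtain ⟨rfl, rfl, rfl, rfl, rfl⟩ := heq
    obtain rfl := hA.injOn hp (.inr (.inr ⟨_, hE, .inl rfl⟩)) hx.symm
    obtain ⟨q, hq, rfl, h⟩ := ih (.inr (.inr ⟨_, hE, .inr rfl⟩)) rfl
    obtain ⟨hj, ho⟩ := (mem_edges.1 hE).bounds hk
    refine ⟨q, hq, rfl, ?_⟩
    rw [← Multiset.coe_add]
    refine .head hE (fun l hl => ?_) (fun l s i => ?_) h
    · funext s i
      rw [unflatten, dif_pos (by omega), test]
      · rfl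
      · rw [ofNat_test hj]
        exact position_lt hl s i
    · simp only [unflatten]
      split_ifs with hl
      · rw [add, vectorOfList_opList_position o hl]
      · rw [ho l s i (by omega)]
        simp

theorem IsMachine.run_of_mrun (hA : S.IsMachine A e) (hk : 1 ≤ S.index) {p q : Control N}
    {c c' : S.Counters} {v : Multiset Y} (h : S.MRun p c v q c') :
    ∃ w : List Y, (w : Multiset Y) = v ∧ A.Run (e p) (S.flatten c) w (e q) (S.flatten c') := by
  induction h with
  | refl p c => exact ⟨[], rfl, .nil _ _⟩
  | @head p p₁ q c c₁ c' u v j o mem test add rest ih =>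
    obtain ⟨w, rfl, h⟩ := ih
    obtain ⟨hj, -⟩ := (mem_edges.1 mem).bounds hk
    refine ⟨u ++ w, (Multiset.coe_add u w).symm,
      .cons ((hA.edges _).2 ⟨_, mem, rfl⟩) (fun n hn => ?_) (fun n => ?_) h⟩
    · rw [ofNat_test hj] at hn
      rw [flatten, test]
      · rfl
      · exact Nat.div_lt_of_lt_mul (by rw [mul_comm]; exact hn)
    · rw [vectorOfList_opList]
      exact add _ _ _

theorem IsMachine.mem_images_iff (hA : S.IsMachine A e) (hk : 1 ≤ S.index) {v : Multiset Y} :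
    v ∈ S.images ↔ ∃ w ∈ A.language, (w : Multiset Y) = v := by
  rw [mem_images_iff_mrun hk]
  constructor
  · intro h
    obtain ⟨w, hw, h⟩ := hA.run_of_mrun hk h
    exact ⟨w, ⟨e none, (hA.final _).2 rfl, by rw [hA.start]; exact h⟩, hw⟩
  · rintro ⟨w, ⟨f, hf, h⟩, rfl⟩
    obtain ⟨q, hq, hf', h⟩ := hA.mrun_of_run hk h (.inl rfl) hA.start
    obtain rfl := hA.injOn hq (.inr (.inl rfl)) (hf'.symm.trans ((hA.final _).1 hf))
    rw [unflatten_zero] at h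
    exact h

end IsMachine

theorem controls_finite : S.controls.Finite := by
  have : S.controls ⊆ ↑({some (.inl none, []), none} ∪ {x | x ∈ S.edges.map fun E => E.1} ∪
      {x | x ∈ S.edges.map fun E => E.2.2.2.2} : Set (Control N)) := by
    rintro x (rfl | rfl | ⟨E, hE, rfl | rfl⟩)
    · simp
    · simp
    · exact .inl (.inr (List.mem_map.2 ⟨E, hE, rfl⟩))
    · exact .inr (List.mem_map.2 ⟨E, hE, rfl⟩)
  exact Set.Finite.subset (((Set.toFinite _).union (List.finite_toSet _)).union
    (List.finite_toSet _)) this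

-- The type of control states is infinite because stacks have no bounded height there. Only the
-- finitely many occurring ones become states; all others are sent to the start state, which is
-- never relevant.
open Classical in
theorem exists_isMachine (S : NetGrammar N Y) :
    ∃ (A : PriorityMachine Y S.numCounters) (e : Control N → A.State), S.IsMachine A e := by
  let x₀ : S.controls := ⟨some (.inl none, []), .inl rfl⟩
  let e : Control N → S.controls := fun x => if h : x ∈ S.controls then ⟨x, h⟩ else x₀
  refine ⟨{
    State := S.controls
    finite_state := controls_finite.to_subtype
    edges := (S.edges.map fun E => (e E.1, E.2.1,
      Fin.ofNat (S.numCounters + 1) (E.2.2.1 * (2 * S.dim)),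
      vectorOfList S.numCounters (S.opList E.2.2.2.1), e E.2.2.2.2)).toFinset
    start := e (some (.inl none, []))
    final := {e none} }, e, rfl, fun q => Iff.rfl, fun x hx y hy h => ?_, fun x => ?_⟩
  · simpa [e, hx, hy] using h
  · simp only [List.mem_toFinset, List.mem_map]
    exact exists_congr fun E => and_congr_right fun _ => eq_comm

end NetGrammar

/-! ### From multisets to Parikh images -/

theorem parikhImage_eq_of_multisets {X : Type*} [DecidableEq X] {L L' : Language X}
    (h : ∀ v : Multiset X, (∃ w ∈ L, (w : Multiset X) = v) ↔ ∃ w ∈ L', (w : Multiset X) = v) :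
    parikhImage L = parikhImage L' := by
  have key : ∀ L : Language X, parikhImage L =
      {f | ∃ v : Multiset X, (∃ w ∈ L, (w : Multiset X) = v) ∧ (fun x => v.count x) = f} := by
    intro L
    ext f
    constructor
    · rintro ⟨w, hw, rfl⟩
      exact ⟨w, ⟨w, hw, rfl⟩, by simp only [Multiset.coe_count]; rfl⟩
    · rintro ⟨_, ⟨w, hw, rfl⟩, rfl⟩
      exact ⟨w, hw, by simp only [Multiset.coe_count]; rfl⟩
  rw [key, key]
  simp only [h]

/-! ### Representation of arbitrary languages -/

/-- The type of nonterminals may be infinite, but finitely many rules have finitely many preimages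
under an injective rule constructor. -/
theorem exists_list_preimage {α β : Type*} (f : α → β) (hf : Function.Injective f)
    (s : Finset β) : ∃ l : List α, ∀ a, a ∈ l ↔ f a ∈ s :=
  ⟨(s.finite_toSet.preimage hf.injOn).toFinset.toList, fun a => by simp⟩

theorem vectorOfList_ofFn {R : Type*} [Zero R] {d : ℕ} (f : Fin d → R) :
    vectorOfList d (List.ofFn f) = f := by
  funext i
  simp [vectorOfList]

-- The net `P'` is `P` itself; it is quantified anew because its dimension has to be `S.dim`, which
-- is `d` only once `S` is known.
open Classical in
theorem exists_represents {X Y : Type} (G : ContextFreeGrammar.{0} X) (k : ℕ) {d : ℕ}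
    (P : PetriNet X d) (h : X → List Y) :
    ∃ (S : NetGrammar G.NT Y) (P' : PetriNet X S.dim), S.index = k ∧
      P'.language = P.language ∧ S.Represents G P' h := by
  obtain ⟨nils, hnils⟩ := exists_list_preimage
    (fun A => (ContextFreeRule.mk A [] : ContextFreeRule X G.NT))
    (fun _ _ h => by simpa using h) G.rules
  obtain ⟨bins, hbins⟩ := exists_list_preimage
    (fun b : G.NT × G.NT × G.NT => (ContextFreeRule.mk b.1
      [Symbol.nonterminal b.2.1, Symbol.nonterminal b.2.2] : ContextFreeRule X G.NT))
    (fun x y h => by simpa [Prod.ext_iff] using h) G.rules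
  obtain ⟨terms, hterms⟩ := exists_list_preimage
    (fun b : G.NT × X => (ContextFreeRule.mk b.1 [Symbol.terminal b.2] : ContextFreeRule X G.NT))
    (fun x y h => by simpa [Prod.ext_iff] using h) G.rules
  refine ⟨⟨d, k, G.initial, nils, terms.flatMap fun b => (P.transitions.toList.filter
      fun t => t.1 = some b.2).map fun t => (b.1, h b.2, List.ofFn t.2), bins,
      (P.transitions.toList.filter fun t => t.1 = none).map fun t => List.ofFn t.2,
      List.ofFn P.initial, P.final.toList.map List.ofFn⟩, P, rfl, rfl, ?_⟩
  refine ⟨rfl, vectorOfList_ofFn _, fun f => ?_, hnils, fun A B C => hbins (A, B, C), fun ν => ?_,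
    fun A u l hl => ?_, fun A x ν hA hν => ?_⟩
  · simp [vectorOfList_ofFn]
  · simp [vectorOfList_ofFn]
  · simp only [List.mem_flatMap, List.mem_map, List.mem_filter, Finset.mem_toList,
      decide_eq_true_eq, Prod.mk.injEq] at hl
    obtain ⟨⟨A', x⟩, hA, ⟨y, ν⟩, ⟨hν, hy⟩, rfl, rfl, rfl⟩ := hl
    simp only at hy
    subst hy
    exact ⟨x, (hterms _).1 hA, by simpa only [vectorOfList_ofFn] using hν, rfl⟩
  · refine ⟨List.ofFn ν, vectorOfList_ofFn ν, ?_⟩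
    simp only [List.mem_flatMap, List.mem_map, List.mem_filter, Finset.mem_toList,
      decide_eq_true_eq]
    exact ⟨(A, x), (hterms _).2 hA, (some x, ν), ⟨hν, rfl⟩, rfl⟩

theorem exists_priorityMachine {Y : Type} [DecidableEq Y] {K : Language Y}
    (hK : InTrioIntersection (fun _ L => IsFiniteIndexCF L) (fun _ L => IsPetriNetLanguage L) K) :
    ∃ (k : ℕ) (A : PriorityMachine Y k), parikhImage A.language = parikhImage K := by
  obtain ⟨X, _, h, _, _, ⟨k, hk, G, hG, rfl⟩, ⟨d, P, rfl⟩, rfl⟩ := hK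
  obtain ⟨S, P', rfl, hP, hS⟩ := exists_represents G k P h
  obtain ⟨A, e, hA⟩ := S.exists_isMachine
  refine ⟨_, A, parikhImage_eq_of_multisets fun v => ?_⟩
  rw [← hA.mem_images_iff hk, hS.mem_images_iff hG, hP]

/-! ### Codes of machines -/

theorem MachineCode.mem_edges (c : MachineCode) (x : Fin (c.maxState + 1) × List ℕ ×
    Fin (c.counters + 1) × (Fin c.counters → ℤ) × Fin (c.maxState + 1)) :
    x ∈ c.toMachine.edges ↔ ∃ e ∈ c.edges, (Fin.ofNat (c.maxState + 1) e.1, e.2.1,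
      Fin.ofNat (c.counters + 1) e.2.2.1, vectorOfList c.counters e.2.2.2.1,
      Fin.ofNat (c.maxState + 1) e.2.2.2.2) = x :=
  List.mem_toFinset.trans List.mem_map

/-! ### Numbering the control states -/

namespace NetGrammar

variable (S : NetGrammar ℕ ℕ)

/-- A bound for the codes of the control states. -/
def controlBound : ℕ :=
  (S.edges.map fun E => Encodable.encode E.1 + Encodable.encode E.2.2.2.2).sum +
    Encodable.encode (some (.inl none, []) : Control ℕ)

/-- The code of an edge of the priority machine. -/
def edgeCode (E : Edge ℕ ℕ) : ℕ × List ℕ × ℕ × List ℤ × ℕ :=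
  (Encodable.encode E.1, E.2.1, E.2.2.1 * (2 * S.dim), S.opList E.2.2.2.1,
    Encodable.encode E.2.2.2.2)

/-- The code of the priority machine. -/
def machineCode : MachineCode where
  counters := S.numCounters
  maxState := S.controlBound
  edges := S.edges.map S.edgeCode
  start := Encodable.encode (some (.inl none, []) : Control ℕ)
  final := [Encodable.encode (none : Control ℕ)]

variable {S}

theorem encode_le_controlBound {x : Control ℕ} (hx : x ∈ S.controls) :
    Encodable.encode x ≤ S.controlBound := by
  rcases hx with rfl | rfl | ⟨E, hE, h⟩
  · exact Nat.le_add_left _ _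
  · rw [Encodable.encode_none]
    exact Nat.zero_le _
  · have h₁ := List.single_le_sum (by simp) _ (List.mem_map_of_mem
      (f := fun E : Edge ℕ ℕ => Encodable.encode E.1 + Encodable.encode E.2.2.2.2) hE)
    refine le_trans ?_ (h₁.trans (Nat.le_add_right _ _))
    rcases h with rfl | rfl
    · exact Nat.le_add_right _ _
    · exact Nat.le_add_left _ _

/-- The bound dominates the code of every control state that occurs, so the reduction of state
numbers modulo `S.controlBound + 1` identifies none of them. -/
theorem isMachine_machineCode : S.IsMachine S.machineCode.toMachine
    fun x => Fin.ofNat (S.controlBound + 1) (Encodable.encode x) where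
  start := rfl
  final q := by
    constructor
    · rintro ⟨n, hn, rfl⟩
      rw [List.mem_singleton.1 hn]
      rfl
    · exact fun h => ⟨_, List.mem_singleton.2 rfl, h⟩
  injOn x hx y hy h := by
    have h' := congrArg Fin.val h
    simp only [Fin.val_ofNat] at h'
    rw [Nat.mod_eq_of_lt (Nat.lt_succ_of_le (encode_le_controlBound hx)),
      Nat.mod_eq_of_lt (Nat.lt_succ_of_le (encode_le_controlBound hy))] at h'
    exact Encodable.encode_injective h'
  edges x := by
    refine (S.machineCode.mem_edges x).trans ⟨?_, ?_⟩
    · rintro ⟨_, h, rfl⟩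
      obtain ⟨E, hE, rfl⟩ := List.mem_map.1 h
      exact ⟨E, hE, rfl⟩
    · rintro ⟨E, hE, rfl⟩
      exact ⟨_, List.mem_map.2 ⟨E, hE, rfl⟩, rfl⟩

end NetGrammar

/-! ### Extracting grammar and net from a code -/

namespace LanguageCode

/-- The left-hand side of a production without symbols on the right. -/
def nilRule (r : ℕ × List (ℕ ⊕ ℕ)) : Option ℕ := if r.2.length = 0 then some r.1 else none

/-- The terminal of a symbol. -/
def terminal? : ℕ ⊕ ℕ → Option ℕ := fun x => Sum.casesOn x some fun _ => none

/-- The nonterminal of a symbol. -/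
def nonterminal? : ℕ ⊕ ℕ → Option ℕ := fun x => Sum.casesOn x (fun _ => none) some

/-- The data of a terminal production. -/
def leafRule (r : ℕ × List (ℕ ⊕ ℕ)) : Option (ℕ × ℕ) :=
  (r.2[0]?.bind terminal?).map fun a => (r.1, a)

/-- The data of a binary production. -/
def binRule (r : ℕ × List (ℕ ⊕ ℕ)) : Option (ℕ × ℕ × ℕ) :=
  (r.2[0]?.bind nonterminal?).bind fun B => (r.2[1]?.bind nonterminal?).map fun C => (r.1, B, C)

/-- The grammar and the net of a language code. -/
def netGrammar (c : LanguageCode) : NetGrammar ℕ ℕ where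
  dim := c.net.dim
  index := c.index
  start := c.grammar.start
  nils := c.grammar.rules.filterMap nilRule
  leaves := (c.grammar.rules.filterMap leafRule).flatMap fun b => c.net.transitions.filterMap
    fun t => if t.1 = some b.2 then some (b.1, c.images.getD b.2 [], t.2) else none
  bins := c.grammar.rules.filterMap binRule
  silent := c.net.transitions.filterMap fun t => if t.1 = none then some t.2 else none
  initMarking := c.net.initial
  final := c.net.final

theorem mem_ruleSet {c : GrammarCode} {r : ContextFreeRule ℕ ℕ} :
    r ∈ c.toGrammar.rules ↔
      ∃ x ∈ c.rules, ContextFreeRule.mk x.1 (x.2.map symbolOfCode) = r :=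
  List.mem_toFinset.trans List.mem_map

theorem symbolOfCode_injective : Function.Injective symbolOfCode := by
  rintro (a | a) (b | b) h <;> simp [symbolOfCode] at h ⊢ <;> exact h

theorem mk_mem_ruleSet {c : GrammarCode} {A : ℕ} (w : List (ℕ ⊕ ℕ)) :
    ContextFreeRule.mk A (w.map symbolOfCode) ∈ c.toGrammar.rules ↔ (A, w) ∈ c.rules := by
  rw [mem_ruleSet]
  constructor
  · rintro ⟨⟨A', w'⟩, hx, h⟩
    simp only [ContextFreeRule.mk.injEq] at h
    obtain ⟨rfl, h⟩ := h
    rwa [← List.map_injective_iff.2 symbolOfCode_injective h]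
  · exact fun h => ⟨_, h, rfl⟩

theorem rule_cases {c : LanguageCode} (hc : c.Valid) {A : ℕ} {w : List (ℕ ⊕ ℕ)}
    (h : (A, w) ∈ c.grammar.rules) :
    (∃ B C, w = [.inr B, .inr C]) ∨ (∃ a, w = [.inl a]) ∨ w = [] := by
  have inj := List.map_injective_iff.2 symbolOfCode_injective
  rcases hc.1 _ ((mk_mem_ruleSet w).2 h) with ⟨B, C, h⟩ | ⟨a, h⟩ | h
  · exact .inl ⟨B, C, inj h⟩
  · exact .inr (.inl ⟨a, inj h⟩)
  · exact .inr (.inr (inj h))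

/-- `leafRule` inspects only the first symbol of a right-hand side. In Chomsky normal form, a
terminal there is the whole right-hand side. -/
theorem mem_leafRules {c : LanguageCode} (hc : c.Valid) {A a : ℕ} :
    (A, a) ∈ c.grammar.rules.filterMap leafRule ↔ (A, [.inl a]) ∈ c.grammar.rules := by
  rw [List.mem_filterMap]
  constructor
  · rintro ⟨⟨A', w⟩, hr, h⟩
    rcases rule_cases hc hr with ⟨B, C, rfl⟩ | ⟨a, rfl⟩ | rfl
    · simp [leafRule, terminal?] at h
    · simp only [leafRule, terminal?, List.getElem?_cons_zero, Option.bind_some, Option.map_some,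
        Option.some.injEq, Prod.mk.injEq] at h
      obtain ⟨rfl, rfl⟩ := h
      exact hr
    · simp [leafRule] at h
  · exact fun h => ⟨_, h, rfl⟩

theorem mem_nilRules {c : LanguageCode} {A : ℕ} :
    A ∈ c.grammar.rules.filterMap nilRule ↔ (A, []) ∈ c.grammar.rules := by
  rw [List.mem_filterMap]
  constructor
  · rintro ⟨⟨A', w⟩, hr, h⟩
    simp only [nilRule, List.length_eq_zero_iff, Option.ite_none_right_eq_some,
      Option.some.injEq] at h
    obtain ⟨rfl, rfl⟩ := h
    exact hr
  · exact fun h => ⟨_, h, rfl⟩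

/-- Two leading nonterminals likewise exhaust the right-hand side by Chomsky normal form, which
validity provides. -/
theorem mem_binRules {c : LanguageCode} (hc : c.Valid) {A B C : ℕ} :
    (A, B, C) ∈ c.grammar.rules.filterMap binRule ↔
      (A, [.inr B, .inr C]) ∈ c.grammar.rules := by
  rw [List.mem_filterMap]
  constructor
  · rintro ⟨⟨A', w⟩, hr, h⟩
    rcases rule_cases hc hr with ⟨B, C, rfl⟩ | ⟨a, rfl⟩ | rfl
    · simp only [binRule, nonterminal?, List.getElem?_cons_zero, List.getElem?_cons_succ,
        Option.bind_some, Option.map_some, Option.some.injEq, Prod.mk.injEq] at h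
      obtain ⟨rfl, rfl, rfl⟩ := h
      exact hr
    · simp [binRule, nonterminal?] at h
    · simp [binRule] at h
  · exact fun h => ⟨_, h, rfl⟩

theorem mem_transitions {c : PetriNetCode} {x : Option ℕ} {ν : Fin c.dim → ℤ} :
    (x, ν) ∈ c.toPetriNet.transitions ↔
      ∃ l, (x, l) ∈ c.transitions ∧ vectorOfList c.dim l = ν := by
  simp [PetriNetCode.toPetriNet]

theorem netGrammar_represents {c : LanguageCode} (hc : c.Valid) :
    c.netGrammar.Represents c.grammar.toGrammar c.net.toPetriNet
      (fun x => c.images.getD x []) where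
  start := rfl
  initMarking := rfl
  final _ := List.mem_toFinset.trans List.mem_map
  nils A := mem_nilRules.trans (mk_mem_ruleSet []).symm
  bins A B C := (mem_binRules hc).trans (mk_mem_ruleSet [.inr B, .inr C]).symm
  silent ν := by
    refine mem_transitions.trans (exists_congr fun l => and_congr_left fun _ => ?_)
    simp [netGrammar]
  of_leaves A u l h := by
    obtain ⟨⟨A', a⟩, hb, h⟩ := List.mem_flatMap.1 h
    obtain ⟨⟨x, l'⟩, ht, h⟩ := List.mem_filterMap.1 h
    obtain ⟨rfl, h⟩ := Option.ite_none_right_eq_some.1 h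
    cases h
    exact ⟨a, (mk_mem_ruleSet [.inl a]).2 ((mem_leafRules hc).1 hb),
      mem_transitions.2 ⟨_, ht, rfl⟩, rfl⟩
  leaves A x ν hA hν := by
    obtain ⟨l, hl, rfl⟩ := mem_transitions.1 hν
    refine ⟨l, rfl, List.mem_flatMap.2 ⟨(A, x), (mem_leafRules hc).2
      ((mk_mem_ruleSet [.inl x]).1 hA), List.mem_filterMap.2 ⟨_, hl, if_pos rfl⟩⟩⟩

theorem parikhImage_machineCode {c : LanguageCode} (hc : c.Valid) :
    parikhImage c.netGrammar.machineCode.toMachine.language = parikhImage c.language := by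
  refine parikhImage_eq_of_multisets fun v => ?_
  have h := NetGrammar.isMachine_machineCode.mem_images_iff (S := c.netGrammar) hc.2 (v := v)
  exact h.symm.trans ((netGrammar_represents hc).mem_images_iff hc.1)

end LanguageCode

/-! ### Computability of the construction -/

namespace NetGrammar

open Primrec

/-- Nonnegative integers have even codes and `Int.negSucc n` has code `2 * n + 1`, so `-n` has code
`2 * n - 1`, with truncated subtraction giving the right value at zero. -/
theorem primrec_neg_cast : Primrec fun n : ℕ => -(n : ℤ) := by
  refine Primrec.encode_iff.1 ((nat_sub.comp nat_double (const 1)).of_eq fun n => ?_)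
  cases n with
  | zero => rfl
  | succ n =>
    have : Encodable.encode (Int.negSucc n) = 2 * n + 1 := rfl
    rw [Nat.cast_succ, ← Int.negSucc_eq, this]
    omega

theorem primrec_negList : Primrec negList :=
  list_map .id (primrec_neg_cast.comp snd)

theorem primrec_unitList (z : ℤ) : Primrec fun i => unitList i z :=
  list_append.comp (list_map list_range (Primrec₂.const 0)) (const [z])

theorem primrec_opVal :
    Primrec fun x : Op × ℕ × Bool × ℕ => opVal x.1 x.2.1 x.2.2.1 x.2.2.2 := by
  have hl : Primrec fun x : Op × ℕ × Bool × ℕ => x.2.1 := fst.comp snd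
  have hs : Primrec fun x : Op × ℕ × Bool × ℕ => x.2.2.1 := fst.comp (snd.comp snd)
  have hi : Primrec fun x : Op × ℕ × Bool × ℕ => x.2.2.2 := snd.comp (snd.comp snd)
  have h₁ : Primrec fun x : Op × ℕ × Bool × ℕ => x.1.1 := fst.comp fst
  have h₂ : Primrec fun x : Op × ℕ × Bool × ℕ => x.1.2 := snd.comp fst
  refine Primrec.ite ?_ ?_ (Primrec.ite ?_ ?_ (const 0))
  · exact (Primrec.eq.comp hl (fst.comp h₁)).and (Primrec.eq.comp hs (fst.comp (snd.comp h₁)))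
  · exact (list_getD 0).comp (snd.comp (snd.comp h₁)) hi
  · exact (Primrec.eq.comp hl (fst.comp h₂)).and (Primrec.eq.comp hs (fst.comp (snd.comp h₂)))
  · exact (list_getD 0).comp (snd.comp (snd.comp h₂)) hi

section Ops

variable {α : Type*} [Primcodable α]

theorem primrec_fireOp {l : α → ℕ} {ν : α → List ℤ} (hl : Primrec l) (hν : Primrec ν) :
    Primrec fun a => fireOp (l a) (ν a) :=
  pair (pair hl (pair (const true) hν)) (pair hl (pair (const true) hν))

theorem primrec_guessOp {l i : α → ℕ} (hl : Primrec l) (hi : Primrec i) :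
    Primrec fun a => guessOp (l a) (i a) :=
  pair (pair hl (pair (const false) ((primrec_unitList 1).comp hi)))
    (pair hl (pair (const true) ((primrec_unitList 1).comp hi)))

theorem primrec_takeOp {l i : α → ℕ} {s : α → Bool} (hl : Primrec l) (hs : Primrec s)
    (hi : Primrec i) : Primrec fun a => takeOp (l a) (s a) (i a) :=
  pair (pair hl (pair (Primrec.not.comp hs) ((primrec_unitList (-1)).comp hi)))
    (pair (succ.comp hl) (pair hs ((primrec_unitList (-1)).comp hi)))

theorem primrec_putOp {l i : α → ℕ} {s : α → Bool} (hl : Primrec l) (hs : Primrec s)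
    (hi : Primrec i) : Primrec fun a => putOp (l a) (s a) (i a) :=
  pair (pair hl (pair hs ((primrec_unitList (-1)).comp hi)))
    (pair (succ.comp hl) (pair hs ((primrec_unitList 1).comp hi)))

theorem primrec_spine : Primrec (spine : Pending ℕ → ℕ) :=
  Primrec.cond fst (fst.comp (snd.comp snd)) (snd.comp (snd.comp snd))

theorem primrec_callee : Primrec (callee : Pending ℕ → ℕ) :=
  Primrec.cond fst (snd.comp (snd.comp snd)) (fst.comp (snd.comp snd))

theorem primrec_control {t : α → Option ℕ ⊕ Bool} {r : α → List (Pending ℕ)} (ht : Primrec t)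
    (hr : Primrec r) : Primrec fun a => (some (t a, r a) : Control ℕ) :=
  option_some.comp (pair ht hr)

theorem primrec_present {A : α → ℕ} (hA : Primrec A) :
    Primrec fun a => (.inl (some (A a)) : Option ℕ ⊕ Bool) :=
  sumInl.comp (option_some.comp hA)

theorem primrec_edge {p q : α → Control ℕ} {u : α → List ℕ} {j : α → ℕ} {o : α → Op}
    (hp : Primrec p) (hu : Primrec u) (hj : Primrec j) (ho : Primrec o) (hq : Primrec q) :
    Primrec fun a => ((p a, u a, j a, o a, q a) : Edge ℕ ℕ) :=
  pair hp (pair hu (pair hj (pair ho hq)))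

/-- A family of grammars with nets whose components are primitive recursive. -/
structure PrimrecFamily (S : α → NetGrammar ℕ ℕ) : Prop where
  dim : Primrec fun a => (S a).dim
  index : Primrec fun a => (S a).index
  start : Primrec fun a => (S a).start
  nils : Primrec fun a => (S a).nils
  leaves : Primrec fun a => (S a).leaves
  bins : Primrec fun a => (S a).bins
  silent : Primrec fun a => (S a).silent
  initMarking : Primrec fun a => (S a).initMarking
  final : Primrec fun a => (S a).final

variable {S : α → NetGrammar ℕ ℕ}

theorem PrimrecFamily.comp {β : Type*} [Primcodable β] (hS : PrimrecFamily S) {f : β → α}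
    (hf : Primrec f) : PrimrecFamily fun b => S (f b) :=
  ⟨hS.dim.comp hf, hS.index.comp hf, hS.start.comp hf, hS.nils.comp hf, hS.leaves.comp hf,
    hS.bins.comp hf, hS.silent.comp hf, hS.initMarking.comp hf, hS.final.comp hf⟩

theorem PrimrecFamily.numCounters (hS : PrimrecFamily S) :
    Primrec fun a => (S a).numCounters :=
  nat_mul.comp hS.index (nat_double.comp hS.dim)

theorem PrimrecFamily.opList (hS : PrimrecFamily S) {o : α → Op} (ho : Primrec o) :
    Primrec fun a => (S a).opList (o a) := by
  refine list_map (list_range.comp hS.numCounters) ?_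
  have hd : Primrec fun x : α × ℕ => (S x.1).dim := hS.dim.comp fst
  exact primrec_opVal.comp (pair (ho.comp fst) (pair (nat_div.comp snd (nat_double.comp hd))
    (pair (nat_bodd.comp (nat_div.comp snd hd)) (nat_mod.comp snd hd))))

theorem PrimrecFamily.pendings (hS : PrimrecFamily S) : Primrec fun a => (S a).pendings := by
  refine list_flatMap hS.bins ?_
  exact list_cons.comp (pair (const true) snd)
    (list_cons.comp (pair (const false) snd) (const []))

theorem PrimrecFamily.pendingStacks (hS : PrimrecFamily S) {m : α → ℕ} (hm : Primrec m) :
    Primrec fun a => (S a).pendingStacks (m a) := by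
  refine nat_rec' (f := m) (g := fun _ => [[]])
    (h := fun a x => (S a).pendings.flatMap fun p => x.2.map fun r => p :: r) hm (const [[]]) ?_
  refine list_flatMap (hS.pendings.comp fst) ?_
  exact list_map (snd.comp (snd.comp fst)) (list_cons.comp (snd.comp fst) snd)

theorem PrimrecFamily.localEdges (hS : PrimrecFamily S) {l : α → ℕ} {r : α → List (Pending ℕ)}
    (hl : Primrec l) (hr : Primrec r) : Primrec fun a => (S a).localEdges (l a) (r a) := by
  have idle : Primrec fun a => (some (.inl none, r a) : Control ℕ) :=
    primrec_control (const _) hr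
  refine list_append.comp ?_ (list_append.comp ?_ (list_append.comp ?_ (list_append.comp ?_ ?_)))
  · exact list_map (list_range.comp hS.dim) (primrec_edge (idle.comp fst) (const []) (const 0)
      (primrec_guessOp (hl.comp fst) snd) (idle.comp fst))
  · exact list_map hS.silent (primrec_edge (idle.comp fst) (const []) (const 0)
      (primrec_fireOp (hl.comp fst) snd) (idle.comp fst))
  · refine list_flatMap hS.leaves ?_
    have h : Primrec fun x : (α × ℕ × List ℕ × List ℤ) × List ℤ =>
        (some (.inl (some x.1.2.1), r x.1.1) : Control ℕ) :=
      primrec_control (primrec_present (fst.comp (snd.comp fst))) (hr.comp (fst.comp fst))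
    exact list_map (hS.silent.comp fst) (primrec_edge h (const []) (const 0)
      (primrec_fireOp (hl.comp (fst.comp fst)) snd) h)
  · exact list_map hS.nils (primrec_edge (idle.comp fst) (const []) (const 0) (const noOp)
      (primrec_control (primrec_present snd) (hr.comp fst)))
  · exact list_map hS.leaves (primrec_edge (idle.comp fst) (fst.comp (snd.comp snd)) (const 0)
      (primrec_fireOp (hl.comp fst) (snd.comp (snd.comp snd)))
      (primrec_control (primrec_present (fst.comp snd)) (hr.comp fst)))

theorem PrimrecFamily.callEdges (hS : PrimrecFamily S) {l : α → ℕ} {p : α → Pending ℕ}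
    {r : α → List (Pending ℕ)} (hl : Primrec l) (hp : Primrec p) (hr : Primrec r) :
    Primrec fun a => (S a).callEdges (l a) (p a) (r a) := by
  have hpr : Primrec fun a => p a :: r a := list_cons.comp hp hr
  have ht : ∀ b : Bool, Primrec fun a => (some (.inr b, p a :: r a) : Control ℕ) := fun b =>
    primrec_control (const _) hpr
  refine list_append.comp ?_ (list_append.comp ?_ ?_)
  · refine list_cons.comp ?_ (list_cons.comp ?_ (list_cons.comp ?_ (list_cons.comp ?_ (const []))))
    · exact primrec_edge (primrec_control (primrec_present (primrec_spine.comp hp)) hr) (const [])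
        (const 0) (const noOp) (primrec_control (const _) hpr)
    · exact primrec_edge (primrec_control (primrec_present (primrec_callee.comp hp)) hpr)
        (const []) (const 0) (const noOp) (ht false)
    · exact primrec_edge (ht false) (const []) (const 0) (const noOp) (ht true)
    · exact primrec_edge (ht true) (const []) (succ.comp hl) (const noOp)
        (primrec_control (primrec_present (fst.comp (snd.comp hp))) hr)
  · exact list_map (list_range.comp hS.dim) (primrec_edge ((ht false).comp fst) (const [])
      (const 0) (primrec_takeOp (hl.comp fst) (fst.comp (hp.comp fst)) snd)
      ((ht false).comp fst))
  · exact list_map (list_range.comp hS.dim) (primrec_edge ((ht true).comp fst) (const [])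
      (const 0) (primrec_putOp (hl.comp fst) (fst.comp (hp.comp fst)) snd)
      ((ht true).comp fst))

theorem PrimrecFamily.finalEdges (hS : PrimrecFamily S) :
    Primrec fun a => (S a).finalEdges := by
  have hi : Primrec fun x : α × List ℕ => (S x.1).index - 1 :=
    nat_sub.comp (hS.index.comp fst) (const 1)
  exact list_map hS.final (primrec_edge (primrec_control (primrec_present (hS.start.comp fst))
    (const [])) (const []) (const 0) (pair (pair hi (pair (const false)
    (primrec_negList.comp (hS.initMarking.comp fst)))) (pair hi (pair (const true)
    (primrec_negList.comp snd)))) (const none))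

theorem PrimrecFamily.edges (hS : PrimrecFamily S) : Primrec fun a => (S a).edges := by
  refine list_append.comp ?_ (list_append.comp ?_ hS.finalEdges)
  · refine list_flatMap (list_range.comp hS.index) ?_
    refine list_flatMap ((hS.comp fst).pendingStacks snd) ?_
    have hc : Primrec fun x : (α × ℕ) × List (Pending ℕ) => x.1.1 := fst.comp fst
    exact (hS.comp hc).localEdges (nat_sub.comp (nat_sub.comp (hS.index.comp hc) (const 1))
      (snd.comp fst)) snd
  · refine list_flatMap (list_range.comp (nat_sub.comp hS.index (const 1))) ?_
    refine list_flatMap ((hS.comp fst).pendingStacks snd) ?_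
    have hc : Primrec fun x : (α × ℕ) × List (Pending ℕ) => x.1.1 := fst.comp fst
    refine list_flatMap (hS.comp hc).pendings ?_
    have hc' : Primrec fun x : ((α × ℕ) × List (Pending ℕ)) × Pending ℕ => x.1.1.1 := hc.comp fst
    exact (hS.comp hc').callEdges (nat_sub.comp (nat_sub.comp (hS.index.comp hc') (const 2))
      (snd.comp (fst.comp fst))) snd (snd.comp fst)

theorem primrec_list_sum : Primrec (List.sum : List ℕ → ℕ) :=
  (list_foldr (h := fun _ x => x.1 + x.2) .id (const 0)
    (nat_add.comp (fst.comp snd) (snd.comp snd))).of_eq fun _ => List.sum_eq_foldr.symm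

theorem PrimrecFamily.machineCode (hS : PrimrecFamily S) :
    Primrec fun a => (S a).machineCode := by
  have hb : Primrec fun a => (S a).controlBound := by
    refine nat_add.comp (primrec_list_sum.comp (list_map hS.edges ?_)) (const _)
    exact nat_add.comp (Primrec.encode.comp (fst.comp snd))
      (Primrec.encode.comp (snd.comp (snd.comp (snd.comp (snd.comp snd)))))
  have he : Primrec fun a => (S a).edges.map (S a).edgeCode := by
    refine list_map hS.edges ?_
    exact pair (Primrec.encode.comp (fst.comp snd)) (pair (fst.comp (snd.comp snd))
      (pair (nat_mul.comp (fst.comp (snd.comp (snd.comp snd)))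
        (nat_double.comp (hS.dim.comp fst)))
      (pair ((hS.comp fst).opList (fst.comp (snd.comp (snd.comp (snd.comp snd)))))
        (Primrec.encode.comp (snd.comp (snd.comp (snd.comp (snd.comp snd))))))))
  exact (Primrec.of_equiv_symm (e := MachineCode.equiv)).comp
    (pair hS.numCounters (pair hb (pair he (pair (const _) (const _)))))

end Ops

end NetGrammar

/-! ### Primitive recursiveness of the extraction -/

namespace LanguageCode

open Primrec

theorem primrec_nilRule : Primrec nilRule :=
  Primrec.ite (Primrec.eq.comp (list_length.comp snd) (const 0)) (option_some.comp fst)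
    (const none)

theorem primrec_terminal? : Primrec terminal? :=
  sumCasesOn .id (option_some.comp snd) (const none)

theorem primrec_nonterminal? : Primrec nonterminal? :=
  sumCasesOn .id (const none) (option_some.comp snd)

theorem primrec_leafRule : Primrec leafRule :=
  option_map (option_bind (list_getElem?.comp snd (const 0)) (primrec_terminal?.comp snd))
    (pair (fst.comp fst) snd)

theorem primrec_binRule : Primrec binRule := by
  refine option_bind (option_bind (list_getElem?.comp snd (const 0))
    (primrec_nonterminal?.comp snd)) ?_
  exact option_map (option_bind (list_getElem?.comp (snd.comp fst) (const 1))
    (primrec_nonterminal?.comp snd)) (pair (fst.comp (fst.comp fst)) (pair (snd.comp fst) snd))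

theorem primrecFamily_netGrammar : NetGrammar.PrimrecFamily netGrammar := by
  have hc : Primrec LanguageCode.equiv := Primrec.of_equiv
  have hg : Primrec fun c : LanguageCode => GrammarCode.equiv c.grammar :=
    (Primrec.of_equiv (e := GrammarCode.equiv)).comp (fst.comp hc)
  have hn : Primrec fun c : LanguageCode => PetriNetCode.equiv c.net :=
    (Primrec.of_equiv (e := PetriNetCode.equiv)).comp (fst.comp (snd.comp (snd.comp hc)))
  have himg : Primrec fun c : LanguageCode => c.images := snd.comp (snd.comp (snd.comp hc))
  have hrules : Primrec fun c : LanguageCode => c.grammar.rules := snd.comp hg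
  have htrans : Primrec fun c : LanguageCode => c.net.transitions := fst.comp (snd.comp hn)
  refine ⟨fst.comp hn, fst.comp (snd.comp hc), fst.comp hg,
    listFilterMap hrules (primrec_nilRule.comp snd), ?_,
    listFilterMap hrules (primrec_binRule.comp snd), ?_, fst.comp (snd.comp (snd.comp hn)),
    snd.comp (snd.comp (snd.comp hn))⟩
  · refine list_flatMap (listFilterMap hrules (primrec_leafRule.comp snd)) ?_
    refine listFilterMap (htrans.comp fst) ?_
    refine Primrec.ite (Primrec.eq.comp (fst.comp snd)
      (option_some.comp (snd.comp (snd.comp fst)))) ?_ (const none)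
    exact option_some.comp (pair (fst.comp (snd.comp fst)) (pair
      ((list_getD []).comp (himg.comp (fst.comp fst)) (snd.comp (snd.comp fst)))
      (snd.comp snd)))
  · exact listFilterMap htrans (Primrec.ite (Primrec.eq.comp (fst.comp snd) (const none))
      (option_some.comp (snd.comp snd)) (const none))

end LanguageCode

/-- The computable map is defined on all codes and is even primitive recursive; validity enters only
its correctness. The first part uses the same structured machine, with data chosen classically for
an arbitrary alphabet. -/
theorem mainTheorem4 :
    (∀ (Y : Type) [Finite Y] [DecidableEq Y] (K : Language Y),
      InTrioIntersection (fun _ L => IsFiniteIndexCF L) (fun _ L => IsPetriNetLanguage L) K →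
      ∃ (k : ℕ) (A : PriorityMachine Y k), parikhImage A.language = parikhImage K) ∧
    (∃ F : LanguageCode → MachineCode, Computable F ∧
      ∀ c : LanguageCode, c.Valid →
        parikhImage (F c).toMachine.language = parikhImage c.language) :=
  ⟨fun _ _ _ _ hK => exists_priorityMachine hK,
    fun c => c.netGrammar.machineCode,
    LanguageCode.primrecFamily_netGrammar.machineCode.to_comp,
    fun _ hc => LanguageCode.parikhImage_machineCode hc⟩
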